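/- Let $n\ge 2$, let $p,q>1$ satisfy $$\max\left\{\frac{q+1+p^{-1}}{pq-1},\ \frac{2+q^{-1}}{pq-1}\right\}=\frac{n-1}{2},$$ and put $$\Theta_1=\Theta_1(n,p,q)=\frac{q+1+p^{-1}}{pq-1}-\frac{n-1}{2},\qquad \Theta_2=\Theta_2(n,p,q)=\frac{2+q^{-1}}{pq-1}-\frac{n-1}{2}.$$ Let $R>0$ and let $u_0,v_0\in H^1(\mathbb R^n)$, $u_1,v_1\in L^2(\mathbb R^n)$ be nonnegative, supported in the ball $B_R=\{|x|\le R\}$, with $u_1\not\equiv 0$ and $v_0\not\equiv 0$. For $\varepsilon>0$ consider the Cauchy problem $$\begin{cases}u_{tt}-\Delta u=|v|^q, & x\in\mathbb R^n,\ t>0,\\ v_{tt}-\Delta v=|\partial_t u|^p, & x\in\mathbb R^n,\ t>0,\\ (u,u_t,v,v_t)(0,x)=\varepsilon\,(u_0,u_1,v_0,v_1)(x), & x\in\mathbb R^n.\end{cases}\tag{1}$$ A weak solution of (1) on $[0,T)$, $0<T\le\infty$, is a pair $u,v\in C([0,T),H^1(\mathbb R^n))\cap C^1([0,T),L^2(\mathbb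 R^n))$ with $\partial_t u\in L^p_{\rm loc}([0,T)\times\mathbb R^n)$ and $v\in L^q_{\rm loc}([0,T)\times\mathbb R^n)$ such that for all $\phi,\psi\in C_0^\infty([0,T)\times\mathbb R^n)$ and all $t\in[0,T)$ $$\int_{\mathbb R^n}\big(\partial_t u\,\phi-u\,\phi_s\big)(t,x)\,dx-\varepsilon\int_{\mathbb R^n}\big(u_1(x)\phi(0,x)-u_0(x)\phi_s(0,x)\big)\,dx+\int_0^t\!\!\int_{\mathbb R^n}u\,(\phi_{ss}-\Delta\phi)\,dx\,ds=\int_0^t\!\!\int_{\mathbb R^n}|v|^q\phi\,dx\,ds,$$ $$\int_{\mathbb R^n}\big(\partial_t v\,\psi-v\,\psi_s\big)(t,x)\,dx-\varepsilon\int_{\mathbb R^n}\big(v_1(x)\psi(0,x)-v_0(x)\psi_s(0,x)\big)\,dx+\int_0^t\!\!\int_{\mathbb R^n}v\,(\psi_{ss}-\Delta\psi)\,dx\,ds=\int_0^t\!\!\int_{\mathbb R^n}|\partial_t u|^p\psi\,dx\,ds.$$ Then there are constants $\varepsilon_0>0$ and $C>0$, depending only on $n,p,q,R,u_0,u_1,v_0,v_1$,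 such that for every $\varepsilon\in(0,\varepsilon_0]$ the following holds. Let $(u,v)$ be a weak solution of (1) on $[0,T)$ with $$\operatorname{supp}u,\ \operatorname{supp}v\subset\{(t,x)\in[0,T)\times\mathbb R^n:\ |x|\le t+R\}.$$ Then $T<\infty$, and $$T\le\begin{cases}\exp\big(C\varepsilon^{-p(pq-1)}\big)&\text{if }\Theta_1=0,\\[2pt] \exp\big(C\varepsilon^{-q(pq-1)}\big)&\text{if }\Theta_2=0,\\[2pt] \exp\big(C\varepsilon^{-\frac{q}{q+1}(pq-1)}\big)&\text{if }\Theta_1=\Theta_2=0.\end{cases}$$ In other words, solutions blow up in finite time, and their lifespan $T(\varepsilon)$ obeys these upper bounds. -/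

import Mathlib

open MeasureTheory Set

open scoped ContDiff

/-- The Euclidean space `ℝⁿ`. -/
abbrev Space (n : ℕ) := EuclideanSpace ℝ (Fin n)

/-- The space `L²(ℝⁿ; F)` of (classes of) square integrable functions. -/
abbrev L2 (n : ℕ) (F : Type) [NormedAddCommGroup F] : Type :=
  Lp F 2 (volume : Measure (Space n))

/-- The half-open time interval `[0, T)`, where `T = ∞` is allowed. -/
def timeInterval (T : EReal) : Set ℝ := {t | 0 ≤ t ∧ (t : EReal) < T}

/-- `g` is the weak gradient of `f`:
`∫ f ∂_w φ dx = - ∫ (g · w) φ dx` for all directions `w` and all `φ ∈ C₀^∞(ℝⁿ)`. -/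
def HasWeakGradient {n : ℕ} (f : L2 n ℝ) (g : L2 n (Space n)) : Prop :=
  ∀ φ : Space n → ℝ, ContDiff ℝ ∞ φ → HasCompactSupport φ → ∀ w : Space n,
    ∫ x, f x * fderiv ℝ φ x w = - ∫ x, inner ℝ (g x) w * φ x

/-- `f ∈ H¹(ℝⁿ)`: `f` and its weak gradient are square integrable. -/
def MemH1 {n : ℕ} (f : L2 n ℝ) : Prop :=
  ∃ g : L2 n (Space n), HasWeakGradient f g

/-- `u ∈ C([0,T), H¹(ℝⁿ))`: the curves `t ↦ u(t)` and `t ↦ ∇u(t)` are continuous in `L²`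
(the norm of `H¹` being equivalent to `‖f‖_{L²} + ‖∇f‖_{L²}`). -/
def ContinuousInH1 {n : ℕ} (T : EReal) (u : ℝ → L2 n ℝ) : Prop :=
  ∃ Du : ℝ → L2 n (Space n),
    (∀ t ∈ timeInterval T, HasWeakGradient (u t) (Du t)) ∧
    ContinuousOn u (timeInterval T) ∧ ContinuousOn Du (timeInterval T)

/-- The time derivative `∂ₜu(t)` of a curve `u : [0,T) → L²(ℝⁿ)` (one-sided at `t = 0`). -/
noncomputable def timeDeriv {n : ℕ} (T : EReal) (u : ℝ → L2 n ℝ) : ℝ → L2 n ℝ :=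
  derivWithin u (timeInterval T)

/-- `w ∈ L^r_loc([0,T) × ℝⁿ)` for a curve `w : [0,T) → L²(ℝⁿ)`: some function of `(t,x)` whose
time slices are the `w(t)` is (measurable and) in `L^r(K)` for each compact `K ⊆ [0,T) × ℝⁿ`. -/
def MemLpLoc {n : ℕ} (r : ℝ) (T : EReal) (w : ℝ → L2 n ℝ) : Prop :=
  ∃ f : ℝ × Space n → ℝ,
    (∀ t ∈ timeInterval T, (fun x => f (t, x)) =ᵐ[volume] w t) ∧
    ∀ K : Set (ℝ × Space n), IsCompact K → K ⊆ timeInterval T ×ˢ univ →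
      MemLp f (ENNReal.ofReal r) (volume.restrict K)

/-- `φ ∈ C₀^∞([0,T) × ℝⁿ)`: `φ` is (the restriction to `t ≥ 0` of) a smooth function whose
support is compact and contained in `{t < T}`; it need not vanish at `t = 0`. -/
structure IsTestFunction {n : ℕ} (T : EReal) (φ : ℝ → Space n → ℝ) : Prop where
  smooth : ContDiff ℝ ∞ (Function.uncurry φ)
  compact_support : HasCompactSupport (Function.uncurry φ)
  support_lt : ∀ z ∈ tsupport (Function.uncurry φ), ((z.1 : ℝ) : EReal) < T

/-- The weak form, tested with `φ` at time `t`, of `w_tt - Δw = F` with data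
`(w, w_t)(0) = ε (w₀, w₁)`; here `wt` stands for `∂ₜw`, and `F` is a function of `(s,x)`. -/
def WeakWaveIdentity {n : ℕ} (ε : ℝ) (w₀ w₁ : L2 n ℝ) (w wt : ℝ → L2 n ℝ)
    (F : ℝ → Space n → ℝ) (φ : ℝ → Space n → ℝ) (t : ℝ) : Prop :=
  (∫ x, (wt t x * φ t x - w t x * deriv (fun s => φ s x) t))
      - ε * (∫ x, (w₁ x * φ 0 x - w₀ x * deriv (fun s => φ s x) 0))
      + (∫ s in (0 : ℝ)..t, ∫ x,
          w s x * (iteratedDeriv 2 (fun τ => φ τ x) s - Laplacian.laplacian (φ s) x))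
    = ∫ s in (0 : ℝ)..t, ∫ x, F s x * φ s x

/-- `(u, v)` is a weak solution on `[0,T)` of
`u_tt - Δu = |v|^q`, `v_tt - Δv = |∂ₜu|^p`, `(u, u_t, v, v_t)(0) = ε (u₀, u₁, v₀, v₁)`. -/
structure IsWeakSolution {n : ℕ} (p q ε : ℝ) (u₀ u₁ v₀ v₁ : L2 n ℝ) (T : EReal)
    (u v : ℝ → L2 n ℝ) : Prop where
  pos : 0 < T
  u_H1 : ContinuousInH1 T u
  u_C1 : ContDiffOn ℝ 1 u (timeInterval T)
  ut_loc : MemLpLoc p T (timeDeriv T u)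
  v_H1 : ContinuousInH1 T v
  v_C1 : ContDiffOn ℝ 1 v (timeInterval T)
  v_loc : MemLpLoc q T v
  eq_u : ∀ φ : ℝ → Space n → ℝ, IsTestFunction T φ → ∀ t ∈ timeInterval T,
    WeakWaveIdentity ε u₀ u₁ u (timeDeriv T u) (fun s x => |v s x| ^ q) φ t
  eq_v : ∀ ψ : ℝ → Space n → ℝ, IsTestFunction T ψ → ∀ t ∈ timeInterval T,
    WeakWaveIdentity ε v₀ v₁ v (timeDeriv T v) (fun s x => |timeDeriv T u s x| ^ p) ψ t

/-- `f` vanishes (almost everywhere) outside the ball `{|x| ≤ R}`, i.e. `supp f ⊆ {|x| ≤ R}`. -/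
def SupportedInBall {n : ℕ} (R : ℝ) (f : L2 n ℝ) : Prop :=
  ∀ᵐ x : Space n, R < ‖x‖ → f x = 0

/-- `supp w ⊆ {(t,x) ∈ [0,T) × ℝⁿ : |x| ≤ t + R}`. As this set is closed in `[0,T) × ℝⁿ` and `w`
is continuous in time, this amounts to a condition on every time slice. -/
def SupportedInCone {n : ℕ} (T : EReal) (R : ℝ) (w : ℝ → L2 n ℝ) : Prop :=
  ∀ t ∈ timeInterval T, SupportedInBall (t + R) (w t)

/-- `Θ₁(n,p,q) = (q + 1 + 1/p)/(pq - 1) - (n - 1)/2`. -/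
noncomputable def Θ₁ (n : ℕ) (p q : ℝ) : ℝ :=
  (q + 1 + p⁻¹) / (p * q - 1) - ((n : ℝ) - 1) / 2

/-- `Θ₂(n,p,q) = (2 + 1/q)/(pq - 1) - (n - 1)/2`. -/
noncomputable def Θ₂ (n : ℕ) (p q : ℝ) : ℝ :=
  (2 + q⁻¹) / (p * q - 1) - ((n : ℝ) - 1) / 2

open scoped Topology

/-! Write m = (n-1)/2. The linear wave equation is tested with plane waves depending only on s - ⟨x,
e⟩ and -s - ⟨x, e⟩, which solve the free equation, so only the values at time t, the data and the
source survive. For each t the two travelling parts are reflections of one another about s = t, so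
that at time t either the wave's time derivative or the wave itself vanishes. This isolates the
moment of ∂ₜw, respectively of w, against f(t - ⟨x, e⟩), with f(z) = (z + R + 2)^(-a) on the
relevant range. Nonnegative data and the convexity, respectively positivity, of f give lower bounds
by ε and by weighted time integrals of the source (`IsSourcedWave.velocity_moment_ge`,
`IsSourcedWave.position_moment_ge`).

In the other direction, averaging these plane waves over all e produces a weight that decays like (s
+ R + 2)^(-m) (s + R + 2 - |x|)^(m - a) when a > m (`waveAverage_le`). By Hölder the averaged moment
of g is then controlled by ∫ |g|^r with explicit powers of s (`waveFunctional_rpow_le`). Three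
values of a are used: a = 0 (crude bound), a = m + 1 (sharp power, no logarithm; used for the data)
and a = m + 1 - 1/r (same power with a factor (1 + log s)^(r-1); used in the iteration).

Together the two directions couple the functionals of ∂ₜu and v. The criticality condition makes one
time integral in the loop exactly ∫ ds/s, that is, a logarithm; if both conditions hold, this
happens twice (`velocity_position_chain`, `position_velocity_chain`, `log_log_chain`). On times up
to exp(2Λ) a bound F ≥ X thus improves to F ≥ c Λ^θ η^k X^(pq) after moving the starting time from S
to S exp(Λη). With η = 1/2, 1/4, ... the starting times never pass exp(2Λ), while the lower bounds
diverge if the first one is large: a contradiction (`no_superlinear_growth`).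

The first bound is a multiple of ε^σ Λ, so the contradiction occurs once Λ^(θ + pq - 1) ε^(σ(pq-1))
exceeds a constant, which yields the lifespan (`lifespan_of_superlinear_growth`). The three cases
differ only in σ (pq, pq, q) and θ + pq - 1 (q, p, q + 1). -/

/-! ### Smooth power profiles for plane waves -/

/-- A smooth function which is at least `1/2` and agrees with the identity on `[1, ∞)`. -/
noncomputable def smoothMax (z : ℝ) : ℝ := 1 / 2 + (z - 1 / 2) * Real.smoothTransition (2 * z - 1)

theorem smoothMax_contDiff : ContDiff ℝ ∞ smoothMax := by
  unfold smoothMax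
  have : ContDiff ℝ ∞ (fun z : ℝ => Real.smoothTransition (2 * z - 1)) :=
    Real.smoothTransition.contDiff.comp (by fun_prop)
  fun_prop

theorem smoothMax_of_one_le {z : ℝ} (hz : 1 ≤ z) : smoothMax z = z := by
  rw [smoothMax, Real.smoothTransition.one_of_one_le (by linarith)]; ring

theorem half_le_smoothMax (z : ℝ) : 1 / 2 ≤ smoothMax z := by
  unfold smoothMax
  rcases le_total z (1 / 2) with h | h
  · rw [Real.smoothTransition.zero_of_nonpos (by linarith)]; simp
  · have := mul_nonneg (sub_nonneg.2 h) (Real.smoothTransition.nonneg (2 * z - 1))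
    linarith

theorem smoothMax_pos (z : ℝ) : 0 < smoothMax z := by linarith [half_le_smoothMax z]

/-- The profile `(z + R + 2)^(-a)`, smoothly extended to the left of `-R - 1`. -/
noncomputable def profile (a R z : ℝ) : ℝ := smoothMax (z + R + 2) ^ (-a)

theorem profile_contDiff (a R : ℝ) : ContDiff ℝ ∞ (profile a R) := by
  unfold profile
  refine ContDiff.rpow_const_of_ne ?_ fun z => (smoothMax_pos _).ne'
  exact smoothMax_contDiff.comp (by fun_prop)

theorem profile_pos (a R z : ℝ) : 0 < profile a R z := Real.rpow_pos_of_pos (smoothMax_pos _) _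

/-- This range is all that matters: on the enlarged cone |x| ≤ s + R + 1 every argument s - ⟨x, e⟩
with |e| ≤ 1 and s ≥ 0 is at least -R - 1, so the base z + R + 2 is at least 1. The extension to
smaller z only serves to make the test functions smooth on the whole space. -/
theorem profile_of_le {a R z : ℝ} (hz : -R - 1 ≤ z) : profile a R z = (z + R + 2) ^ (-a) := by
  rw [profile, smoothMax_of_one_le (by linarith)]

theorem profile_zero (R z : ℝ) : profile 0 R z = 1 := by simp [profile]

theorem profile_le {a : ℝ} (ha : 0 ≤ a) (R z : ℝ) : profile a R z ≤ 2 ^ a := by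
  unfold profile
  calc smoothMax (z + R + 2) ^ (-a) ≤ (1 / 2 : ℝ) ^ (-a) :=
        Real.rpow_le_rpow_of_nonpos (by norm_num) (half_le_smoothMax _) (by linarith)
    _ = 2 ^ a := by
        rw [one_div, Real.inv_rpow (by norm_num), ← Real.rpow_neg (by norm_num), neg_neg]

/-! ### Directions and the volume of spherical caps -/

/-- The direction of a vector. -/
noncomputable def direction {n : ℕ} (y : Space n) : Space n := ‖y‖⁻¹ • y

theorem norm_direction {n : ℕ} {y : Space n} (hy : y ≠ 0) : ‖direction y‖ = 1 := by
  rw [direction, norm_smul, norm_inv, norm_norm, inv_mul_cancel₀ (norm_ne_zero_iff.2 hy)]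

theorem norm_direction_le {n : ℕ} (y : Space n) : ‖direction y‖ ≤ 1 := by
  rcases eq_or_ne y 0 with rfl | hy
  · simp [direction]
  · exact (norm_direction hy).le

theorem measurable_direction {n : ℕ} : Measurable (direction : Space n → Space n) := by
  unfold direction; fun_prop

theorem inner_direction_le {n : ℕ} (x y : Space n) : inner ℝ x (direction y) ≤ ‖x‖ :=
  (real_inner_le_norm _ _).trans (mul_le_of_le_one_right (norm_nonneg _) (norm_direction_le y))

/-- In an orthonormal basis starting with e, the quantity ‖y‖² - ⟨e, y⟩² is the sum of the squares
of the other k coordinates, so the set lies in a thin box. -/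
theorem volume_box_le (k : ℕ) {δ : ℝ} (hδ : 0 ≤ δ) (e : Space (k + 1)) (he : ‖e‖ = 1)
    {s : Set (Space (k + 1))}
    (hs : ∀ y ∈ s, ‖y‖ ≤ 1 ∧ (‖y‖ ^ 2 - inner ℝ e y ^ 2 ≤ 2 * δ)) :
    volume.real s ≤ 2 ^ (k + 1) * (2 * δ) ^ ((k : ℝ) / 2) := by
  obtain ⟨b, hb⟩ := Orthonormal.exists_orthonormalBasis_extension_of_card_eq (𝕜 := ℝ)
    (E := Space (k + 1)) (ι := Fin (k + 1)) (by simp) (v := fun _ => e) (s := {0})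
    (by
      constructor
      · intro i; simpa using he
      · intro i j hij; exact absurd (Subsingleton.elim i j) hij)
  have hb0 : b 0 = e := hb 0 (by simp)
  -- Half-widths of the box: 1 along e, and √(2δ) in each of the k orthogonal directions.
  let r : Fin (k + 1) → ℝ := Fin.cons 1 (fun _ => √(2 * δ))
  have hr : ∀ i, 0 ≤ r i := by
    intro i; refine Fin.cases ?_ (fun j => ?_) i <;> simp [r]
  have hsub : s ⊆ (fun y => WithLp.ofLp (b.repr y)) ⁻¹' (Icc (-r) r) := by
    intro y hy
    obtain ⟨h1, h2⟩ := hs y hy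
    have key : ∀ i, |b.repr y i| ≤ r i := by
      intro i
      rw [b.repr_apply_apply]
      refine Fin.cases ?_ (fun j => ?_) i
      · simp only [r, Fin.cons_zero]
        exact (abs_real_inner_le_norm _ _).trans (by rw [b.norm_eq_one, one_mul]; exact h1)
      · simp only [r, Fin.cons_succ]
        apply Real.abs_le_sqrt
        have hsum := b.sum_sq_norm_inner_right y
        rw [Fin.sum_univ_succ, hb0] at hsum
        have := Finset.single_le_sum (f := fun j : Fin k => ‖inner ℝ (b j.succ) y‖ ^ 2)
          (fun _ _ => by positivity) (Finset.mem_univ j)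
        simp only [Real.norm_eq_abs, sq_abs] at this hsum
        linarith
    exact ⟨fun i => (abs_le.1 (key i)).1, fun i => (abs_le.1 (key i)).2⟩
  have hmp : MeasurePreserving (fun y => WithLp.ofLp (b.repr y)) volume volume :=
    (PiLp.volume_preserving_ofLp (Fin (k + 1))).comp b.repr.measurePreserving
  have hvol : volume s ≤ ENNReal.ofReal (2 ^ (k + 1) * (2 * δ) ^ ((k : ℝ) / 2)) := by
    refine (measure_mono hsub).trans ?_
    rw [hmp.measure_preimage measurableSet_Icc.nullMeasurableSet, Real.volume_Icc_pi,
      ← ENNReal.ofReal_prod_of_nonneg (fun i _ => by simpa using by linarith [hr i])]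
    apply ENNReal.ofReal_le_ofReal
    rw [Fin.prod_univ_succ]
    simp only [r, Pi.neg_apply, Fin.cons_zero, Fin.cons_succ, Finset.prod_const, Finset.card_univ,
      Fintype.card_fin]
    have : √(2 * δ) ^ k = (2 * δ) ^ ((k : ℝ) / 2) := by
      rw [Real.sqrt_eq_rpow, ← Real.rpow_natCast, ← Real.rpow_mul (by positivity)]
      congr 1; ring
    rw [← this, sub_neg_eq_add, sub_neg_eq_add, ← two_mul (√(2 * δ)), mul_pow, pow_succ]
    apply le_of_eq; ring
  exact ENNReal.toReal_le_of_le_ofReal (by positivity) hvol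

/-- The directions within angle ~ √δ of e form a cap of dimension n - 1, hence the power
δ^((n-1)/2). Letting y range over the unit ball and using only its direction replaces surface
measure by Lebesgue measure, up to a constant factor. -/
theorem volume_cap_le {n : ℕ} (hn : 2 ≤ n) : ∃ C : ℝ, 0 < C ∧ ∀ e : Space n, ‖e‖ = 1 → ∀ δ : ℝ,
    0 ≤ δ → (volume.restrict (Metric.ball (0 : Space n) 1)).real
      {y | 1 - inner ℝ e (direction y) ≤ δ} ≤ C * δ ^ (((n : ℝ) - 1) / 2) := by
  obtain ⟨k, rfl⟩ : ∃ k, n = k + 1 := ⟨n - 1, by omega⟩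
  refine ⟨2 ^ (k + 1) * 2 ^ ((k : ℝ) / 2), by positivity, fun e he δ hδ => ?_⟩
  have hm : MeasurableSet {y : Space (k + 1) | 1 - inner ℝ e (direction y) ≤ δ} := by
    apply measurableSet_le _ measurable_const
    exact measurable_const.sub (measurable_const.inner measurable_direction)
  rw [measureReal_restrict_apply hm]
  refine (volume_box_le k hδ e he ?_).trans (le_of_eq ?_)
  · rintro y ⟨hy, hy1⟩
    have hy1' : ‖y‖ < 1 := by simpa using hy1
    refine ⟨hy1'.le, ?_⟩
    have hc := abs_real_inner_le_norm e y
    rw [he, one_mul] at hc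
    -- For δ ≥ 1 the condition is implied by ‖y‖ ≤ 1. Otherwise ⟨e, y⟩ ≥ (1 - δ)‖y‖ ≥ 0 may be
    -- squared, and 1 - (1 - δ)² ≤ 2δ.
    rcases le_total 1 δ with h | h
    · nlinarith [norm_nonneg y, sq_nonneg (inner ℝ e y)]
    · have hy' : (1 - δ) * ‖y‖ ≤ inner ℝ e y := by
        rcases eq_or_ne y 0 with rfl | h0
        · simp
        · have hpos := norm_pos_iff.2 h0
          have h2 : inner ℝ e (direction y) = ‖y‖⁻¹ * inner ℝ e y := by
            rw [direction, inner_smul_right]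
          have h3 : 1 - δ ≤ ‖y‖⁻¹ * inner ℝ e y := by
            have : 1 - inner ℝ e (direction y) ≤ δ := hy
            linarith
          have := mul_le_mul_of_nonneg_right h3 hpos.le
          rwa [mul_comm ‖y‖⁻¹, mul_assoc, inv_mul_cancel₀ hpos.ne', mul_one] at this
      have h4 : ((1 - δ) * ‖y‖) ^ 2 ≤ inner ℝ e y ^ 2 := by
        apply pow_le_pow_left₀ (by have := norm_nonneg y; nlinarith) hy'
      have h5 : ‖y‖ ^ 2 ≤ 1 := by nlinarith [norm_nonneg y]
      nlinarith [sq_nonneg ‖y‖, sq_nonneg δ]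
  · rw [Real.mul_rpow (by norm_num) hδ]
    push_cast
    rw [add_sub_cancel_right]
    ring

/-- Layer-cake formula: each superlevel set of the integrand is a sublevel set of g, whose measure
is bounded by `hcap`. The heights stop at z^(-a), and m < a makes t^(-m/a) integrable at 0. -/
theorem integral_rpow_layer_le {α : Type*} [MeasurableSpace α] {μ : Measure α} [IsFiniteMeasure μ]
    {g : α → ℝ} (hg : Measurable g) (hg0 : ∀ y, 0 ≤ g y) {C m a z ρ : ℝ} (hm : 0 < m) (hma : m < a)
    (hz : 0 < z) (hρ : 0 < ρ) (hcap : ∀ δ, 0 ≤ δ → μ.real {y | g y ≤ δ} ≤ C * δ ^ m) :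
    ∫ y, (z + ρ * g y) ^ (-a) ∂μ ≤ C * (a / (a - m)) * ρ ^ (-m) * z ^ (m - a) := by
  have ha : 0 < a := hm.trans hma
  have hpos : ∀ y, 0 < z + ρ * g y := fun y => by have := mul_nonneg hρ.le (hg0 y); linarith
  have hbd : ∀ y, (z + ρ * g y) ^ (-a) ≤ z ^ (-a) := fun y =>
    Real.rpow_le_rpow_of_nonpos hz (by have := mul_nonneg hρ.le (hg0 y); linarith) (by linarith)
  have hint : Integrable (fun y => (z + ρ * g y) ^ (-a)) μ := by
    refine Integrable.of_bound (C := z ^ (-a))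
      (((hg.const_mul ρ).const_add z).pow_const (-a)).aestronglyMeasurable (ae_of_all _ fun y => ?_)
    rw [Real.norm_of_nonneg (Real.rpow_nonneg (hpos y).le _)]; exact hbd y
  rw [hint.integral_eq_integral_Ioc_meas_le (ae_of_all _ fun y => Real.rpow_nonneg (hpos y).le _)
    (ae_of_all _ hbd)]
  have hexp : -1 < -(m / a) := by
    rw [neg_lt_neg_iff, div_lt_one ha]; exact hma
  have hM : 0 ≤ z ^ (-a) := Real.rpow_nonneg hz.le _
  have hII : IntervalIntegrable (fun t : ℝ => C * ρ ^ (-m) * t ^ (-(m / a))) volume 0 (z ^ (-a)) :=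
    (intervalIntegral.intervalIntegrable_rpow' hexp).const_mul _
  have hle : ∀ t ∈ Ioc 0 (z ^ (-a)), μ.real {y | t ≤ (z + ρ * g y) ^ (-a)} ≤
      C * ρ ^ (-m) * t ^ (-(m / a)) := by
    intro t ht
    have hsub : {y | t ≤ (z + ρ * g y) ^ (-a)} ⊆ {y | g y ≤ t ^ (-(1 / a)) / ρ} := by
      intro y hy
      have h1 := Real.rpow_le_rpow_of_nonpos ht.1 hy (z := -(1 / a)) (by
        rw [neg_nonpos]; positivity)
      rw [← Real.rpow_mul (hpos y).le] at h1
      have h2 : -a * -(1 / a) = 1 := by field_simp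
      rw [h2, Real.rpow_one] at h1
      show g y ≤ _
      rw [le_div_iff₀ hρ]; linarith
    refine (measureReal_mono hsub).trans ((hcap _ (by
      have := Real.rpow_nonneg ht.1.le (-(1 / a)); positivity)).trans (le_of_eq ?_))
    rw [Real.div_rpow (Real.rpow_nonneg ht.1.le _) hρ.le, ← Real.rpow_mul ht.1.le,
      Real.rpow_neg hρ.le, div_eq_mul_inv, show -(1 / a) * m = -(m / a) by ring]
    ring
  calc ∫ t in Ioc 0 (z ^ (-a)), μ.real {y | t ≤ (z + ρ * g y) ^ (-a)}
      ≤ ∫ t in Ioc 0 (z ^ (-a)), C * ρ ^ (-m) * t ^ (-(m / a)) := by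
        apply integral_mono_of_nonneg
        · exact ae_of_all _ fun t => measureReal_nonneg
        · exact (intervalIntegrable_iff_integrableOn_Ioc_of_le hM).1 hII
        · exact (ae_restrict_iff' measurableSet_Ioc).2 (ae_of_all _ hle)
    _ = C * (a / (a - m)) * ρ ^ (-m) * z ^ (m - a) := by
        rw [← intervalIntegral.integral_of_le hM, intervalIntegral.integral_const_mul,
          integral_rpow (Or.inl hexp), Real.zero_rpow (by linarith), ← Real.rpow_mul hz.le]
        have h1 : -a * (-(m / a) + 1) = m - a := by field_simp; ring
        have h2 : -(m / a) + 1 = (a - m) / a := by field_simp; ring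
        have h3 : a - m ≠ 0 := by linarith
        rw [h1, h2]; field_simp; ring

/-! ### Decay of averaged plane waves -/

/-- The average of the plane waves `profile a R (s - ⟨x, ω⟩)` over the directions `ω`. -/
noncomputable def waveAverage {n : ℕ} (a R s : ℝ) (x : Space n) : ℝ :=
  ∫ y in Metric.ball (0 : Space n) 1, profile a R (s - inner ℝ x (direction y))

theorem waveAverage_nonneg {n : ℕ} (a R s : ℝ) (x : Space n) : 0 ≤ waveAverage a R s x :=
  integral_nonneg fun _ => (profile_pos _ _ _).le

theorem measurable_profile_inner {n : ℕ} (a R s : ℝ) :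
    Measurable (fun z : Space n × Space n => profile a R (s - inner ℝ z.1 (direction z.2))) :=
  (profile_contDiff a R).continuous.measurable.comp
    (measurable_const.sub (measurable_fst.inner (measurable_direction.comp measurable_snd)))

instance isFiniteMeasure_restrict_ball {n : ℕ} :
    IsFiniteMeasure ((volume : Measure (Space n)).restrict (Metric.ball 0 1)) :=
  isFiniteMeasure_restrict.2 measure_ball_lt_top.ne

theorem waveAverage_eq {n : ℕ} (a : ℝ) {R s : ℝ} {x : Space n} (hx : ‖x‖ ≤ s + R + 1) :
    waveAverage a R s x = ∫ y in Metric.ball (0 : Space n) 1,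
      (s + R + 2 - inner ℝ x (direction y)) ^ (-a) := by
  unfold waveAverage
  congr 1
  ext y
  rw [profile_of_le (by have := inner_direction_le x y; linarith)]
  congr 1; ring

theorem two_mul_rpow_neg_le {r T m : ℝ} (hm : 0 ≤ m) (hT : 0 < T) (h : T / 2 ≤ r) :
    r ^ (-m) ≤ 2 ^ m * T ^ (-m) := by
  refine (Real.rpow_le_rpow_of_nonpos (by linarith) h (by linarith)).trans (le_of_eq ?_)
  rw [Real.div_rpow hT.le (by norm_num), Real.rpow_neg (by norm_num : (0 : ℝ) ≤ 2)]
  field_simp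

/-- Well inside the cone no averaging is needed: s + R + 2 - ‖x‖ is comparable to s + R + 2, so the
pointwise bound by (s + R + 2 - ‖x‖)^(-a) suffices after splitting off the exponent -m. -/
theorem waveAverage_le_of_norm_le {n : ℕ} {a m R s : ℝ} (hm : 0 ≤ m) (ha : 0 ≤ a) {x : Space n}
    (hx : ‖x‖ ≤ s + R + 1) (h : ‖x‖ ≤ (s + R + 2) / 2) :
    waveAverage a R s x ≤ (2 ^ m * (s + R + 2) ^ (-m) * (s + R + 2 - ‖x‖) ^ (m - a)) *
      (volume.restrict (Metric.ball (0 : Space n) 1)).real univ := by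
  have hz0 : 0 < s + R + 2 - ‖x‖ := by linarith
  have hT0 : 0 < s + R + 2 := by linarith [norm_nonneg x]
  rw [waveAverage_eq a hx]
  have hb : ∀ y : Space n, ‖(s + R + 2 - inner ℝ x (direction y)) ^ (-a)‖ ≤
      (s + R + 2 - ‖x‖) ^ (-a) := by
    intro y
    have hi := inner_direction_le x y
    rw [Real.norm_of_nonneg (Real.rpow_nonneg (by linarith) _)]
    exact Real.rpow_le_rpow_of_nonpos hz0 (by linarith) (by linarith)
  have h1 := norm_integral_le_of_norm_le_const (μ := volume.restrict (Metric.ball (0 : Space n) 1))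
    (ae_of_all _ hb)
  have h2 : (s + R + 2 - ‖x‖) ^ (-a) ≤
      2 ^ m * (s + R + 2) ^ (-m) * (s + R + 2 - ‖x‖) ^ (m - a) := by
    have e1 : (s + R + 2 - ‖x‖) ^ (-a) = (s + R + 2 - ‖x‖) ^ (-m) *
        (s + R + 2 - ‖x‖) ^ (m - a) := by
      rw [← Real.rpow_add hz0]; congr 1; ring
    rw [e1]
    exact mul_le_mul_of_nonneg_right (two_mul_rpow_neg_le hm hT0 (by linarith))
      (Real.rpow_nonneg hz0.le _)
  exact ((Real.le_norm_self _).trans h1).trans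
    (mul_le_mul_of_nonneg_right h2 measureReal_nonneg)

/-- Near the light cone the gain comes from the directions: only those close to that of x make the
phase small, and the cap bound, with ‖x‖ comparable to s + R + 2, produces the factor (s + R +
2)^(-m). -/
theorem waveAverage_le_of_le_norm {n : ℕ} {C m : ℝ} (hC : 0 < C) (hm : 0 < m)
    (hcap : ∀ e : Space n, ‖e‖ = 1 → ∀ δ : ℝ,
      0 ≤ δ → (volume.restrict (Metric.ball (0 : Space n) 1)).real
        {y | 1 - inner ℝ e (direction y) ≤ δ} ≤ C * δ ^ m)
    {a R s : ℝ} (ha : m < a) {x : Space n} (hx : ‖x‖ ≤ s + R + 1)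
    (hx0 : 0 < ‖x‖) (h : (s + R + 2) / 2 ≤ ‖x‖) :
    waveAverage a R s x ≤
      C * (a / (a - m)) * (2 ^ m * (s + R + 2) ^ (-m)) * (s + R + 2 - ‖x‖) ^ (m - a) := by
  have hz0 : 0 < s + R + 2 - ‖x‖ := by linarith
  have hT0 : 0 < s + R + 2 := by linarith [norm_nonneg x]
  rw [waveAverage_eq a hx]
  have hne : ‖direction x‖ = 1 := norm_direction (norm_pos_iff.1 hx0)
  -- The phase splits into the distance to the cone and ‖x‖ times the angular defect, which is the
  -- form required by `integral_rpow_layer_le`.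
  have hexp : ∀ y : Space n, (s + R + 2 - inner ℝ x (direction y)) =
      (s + R + 2 - ‖x‖) + ‖x‖ * (1 - inner ℝ (direction x) (direction y)) := by
    intro y
    rw [direction.eq_1 x, real_inner_smul_left]; field_simp; ring
  have h1 := integral_rpow_layer_le (μ := volume.restrict (Metric.ball (0 : Space n) 1))
    (g := fun y => 1 - inner ℝ (direction x) (direction y))
    (measurable_const.sub (measurable_const.inner measurable_direction))
    (fun y => by have := inner_direction_le (direction x) y; linarith) hm ha hz0 hx0
    (hcap _ hne)
  simp_rw [hexp]
  refine h1.trans ?_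
  have hk : 0 ≤ C * (a / (a - m)) := by
    have : 0 < a - m := by linarith
    have : 0 < a := by linarith
    positivity
  exact mul_le_mul_of_nonneg_right (mul_le_mul_of_nonneg_left
    (two_mul_rpow_neg_le hm.le hT0 h) hk) (Real.rpow_nonneg hz0.le _)

theorem waveAverage_le {n : ℕ} (hn : 2 ≤ n) {a : ℝ} (ha : ((n : ℝ) - 1) / 2 < a) :
    ∃ C : ℝ, 0 < C ∧ ∀ R s : ℝ, ∀ x : Space n, ‖x‖ ≤ s + R + 1 → waveAverage a R s x ≤
      C * (s + R + 2) ^ (-(((n : ℝ) - 1) / 2)) * (s + R + 2 - ‖x‖) ^ (((n : ℝ) - 1) / 2 - a) := by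
  obtain ⟨C, hC, hcap⟩ := volume_cap_le hn
  have hm : 0 < ((n : ℝ) - 1) / 2 := by
    have : (2 : ℝ) ≤ n := by exact_mod_cast hn
    linarith
  generalize ((n : ℝ) - 1) / 2 = m at *
  have hV0 : 0 ≤ (volume.restrict (Metric.ball (0 : Space n) 1)).real univ := measureReal_nonneg
  have ha0 : 0 < a := by linarith
  have ham : 0 < a - m := by linarith
  refine ⟨C * (a / (a - m)) * 2 ^ m +
    (volume.restrict (Metric.ball (0 : Space n) 1)).real univ * 2 ^ m, by positivity,
    fun R s x hx => ?_⟩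
  have hTm := Real.rpow_nonneg (by linarith [norm_nonneg x] : 0 ≤ s + R + 2) (-m)
  have hzm := Real.rpow_nonneg (by linarith : 0 ≤ s + R + 2 - ‖x‖) (m - a)
  have hXY := mul_nonneg hTm hzm
  rcases le_or_gt ‖x‖ ((s + R + 2) / 2) with h | h
  · have h1 := waveAverage_le_of_norm_le (m := m) hm.le ha0.le hx h
    have : 0 ≤ C * (a / (a - m)) * 2 ^ m *
      ((s + R + 2) ^ (-m) * (s + R + 2 - ‖x‖) ^ (m - a)) := by positivity
    linear_combination h1 + this
  · have hx0 : 0 < ‖x‖ := by linarith [norm_nonneg x]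
    have h1 := waveAverage_le_of_le_norm hC hm hcap ha hx hx0 h.le
    have : 0 ≤ (volume.restrict (Metric.ball (0 : Space n) 1)).real univ * 2 ^ m *
      ((s + R + 2) ^ (-m) * (s + R + 2 - ‖x‖) ^ (m - a)) := by positivity
    linear_combination h1 + this

/-! ### Hölder bounds for the averaged moments -/

/-- Polar coordinates, with the density r^(n-1) bounded by T^(n-1) and the substitution z = T - r.
What remains is the integral across the cone, whose exponent κ decides between boundedness and a
logarithm. -/
theorem integral_ball_radial_le {n : ℕ} (hn : 1 ≤ n) {T κ : ℝ} (hT : 1 ≤ T) :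
    IntegrableOn (fun x : Space n => (T - ‖x‖) ^ (-κ)) (Metric.closedBall 0 (T - 1)) ∧
    ∫ x in Metric.closedBall (0 : Space n) (T - 1), (T - ‖x‖) ^ (-κ) ≤
      n * volume.real (Metric.ball (0 : Space n) 1) * T ^ ((n : ℝ) - 1) *
        ∫ z in (1 : ℝ)..T, z ^ (-κ) := by
  have hcont : ContinuousOn (fun r : ℝ => (T - r) ^ (-κ)) (Icc 0 (T - 1)) :=
    ContinuousOn.rpow_const (by fun_prop) fun r hr => Or.inl (by have := hr.2; intro; linarith)
  constructor
  · apply ContinuousOn.integrableOn_compact (isCompact_closedBall _ _)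
    refine hcont.comp continuous_norm.continuousOn ?_
    intro x hx; exact ⟨norm_nonneg _, by simpa using hx⟩
  have : Nonempty (Fin n) := ⟨⟨0, hn⟩⟩
  have h1 : ∫ x in Metric.closedBall (0 : Space n) (T - 1), (T - ‖x‖) ^ (-κ) =
      ∫ x : Space n, (Iic (T - 1)).indicator (fun r => (T - r) ^ (-κ)) ‖x‖ := by
    rw [← integral_indicator measurableSet_closedBall]
    congr 1; ext x
    by_cases hx : ‖x‖ ≤ T - 1
    · rw [indicator_of_mem (by simpa using hx), indicator_of_mem (show ‖x‖ ∈ Iic (T - 1) from hx)]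
    · rw [indicator_of_notMem (by simpa using hx), indicator_of_notMem (show ‖x‖ ∉ Iic (T - 1) from hx)]
  rw [h1, integral_fun_norm_addHaar volume (fun r => (Iic (T - 1)).indicator (fun r => (T - r) ^ (-κ)) r)]
  simp only [finrank_euclideanSpace, Fintype.card_fin, nsmul_eq_mul, smul_eq_mul]
  rw [mul_assoc, mul_assoc]
  gcongr
  have h2 : ∫ y in Ioi (0 : ℝ), y ^ (n - 1) * (Iic (T - 1)).indicator (fun r => (T - r) ^ (-κ)) y =
      ∫ y in (0 : ℝ)..(T - 1), y ^ (n - 1) * (T - y) ^ (-κ) := by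
    rw [intervalIntegral.integral_of_le (by linarith), ← Ioi_inter_Iic, ← setIntegral_indicator measurableSet_Iic]
    congr 1; ext y; rw [indicator_mul_right]
  rw [h2]
  have h3 : ∫ z in (1 : ℝ)..T, z ^ (-κ) = ∫ y in (0 : ℝ)..(T - 1), (T - y) ^ (-κ) := by
    have := intervalIntegral.integral_comp_sub_left (a := 0) (b := T - 1) (fun z => z ^ (-κ)) T
    rw [this]; congr 1 <;> ring
  rw [h3, ← intervalIntegral.integral_const_mul]
  have hu : uIcc 0 (T - 1) = Icc 0 (T - 1) := uIcc_of_le (by linarith)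
  apply intervalIntegral.integral_mono_on (by linarith)
  · exact ((continuous_pow _).continuousOn.mul (hu ▸ hcont)).intervalIntegrable
  · exact (continuousOn_const.mul (hu ▸ hcont)).intervalIntegrable
  · intro y hy
    have h4 : y ^ (n - 1) ≤ T ^ ((n : ℝ) - 1) := by
      rw [show (n : ℝ) - 1 = ((n - 1 : ℕ) : ℝ) by push_cast [hn]; ring, Real.rpow_natCast]
      exact pow_le_pow_left₀ hy.1 (by linarith [hy.2]) _
    exact mul_le_mul_of_nonneg_right h4 (Real.rpow_nonneg (by linarith [hy.2]) _)

/-- The average over the directions `ω` of the moments of `g` against the plane waves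
`profile a R (s - ⟨x, ω⟩)`. -/
noncomputable def waveFunctional {n : ℕ} (a R s : ℝ) (g : Space n → ℝ) : ℝ :=
  ∫ y in Metric.ball (0 : Space n) 1, ∫ x, g x * profile a R (s - inner ℝ x (direction y))

theorem integrable_mul_profile {n : ℕ} {a : ℝ} (ha : 0 ≤ a) (R s : ℝ) {g : Space n → ℝ}
    (hg : Integrable g) : Integrable
      (fun z : Space n × Space n => g z.1 * profile a R (s - inner ℝ z.1 (direction z.2)))
      (volume.prod (volume.restrict (Metric.ball 0 1))) := by
  have h1 : Integrable (fun z : Space n × Space n => g z.1)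
      (volume.prod (volume.restrict (Metric.ball (0 : Space n) 1))) := hg.comp_fst _
  refine h1.mul_bdd (c := 2 ^ a) (measurable_profile_inner a R s).aestronglyMeasurable
    (ae_of_all _ fun z => ?_)
  rw [Real.norm_of_nonneg (profile_pos _ _ _).le]
  exact profile_le ha _ _

theorem integrable_waveFunctional {n : ℕ} {a : ℝ} (ha : 0 ≤ a) (R s : ℝ) {g : Space n → ℝ}
    (hg : Integrable g) : IntegrableOn
      (fun y => ∫ x, g x * profile a R (s - inner ℝ x (direction y)))
      (Metric.ball (0 : Space n) 1) :=
  (integrable_mul_profile ha R s hg).integral_prod_right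

/-- Fubini connects the two uses of the functional: direction by direction it is bounded below
through the equation, while as a single weighted integral it is bounded above by Hölder. -/
theorem waveFunctional_eq {n : ℕ} {a : ℝ} (ha : 0 ≤ a) (R s : ℝ) {g : Space n → ℝ}
    (hg : Integrable g) : waveFunctional a R s g = ∫ x, g x * waveAverage a R s x := by
  unfold waveFunctional waveAverage
  rw [← integral_integral_swap (integrable_mul_profile ha R s hg)]
  simp_rw [integral_const_mul]

theorem waveAverage_le_const {n : ℕ} {a : ℝ} (ha : 0 ≤ a) (R s : ℝ) (x : Space n) :
    waveAverage a R s x ≤ 2 ^ a * (volume.restrict (Metric.ball (0 : Space n) 1)).real univ := by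
  unfold waveAverage
  refine (Real.le_norm_self _).trans (norm_integral_le_of_norm_le_const (ae_of_all _ fun y => ?_))
  rw [Real.norm_of_nonneg (profile_pos _ _ _).le]
  exact profile_le ha _ _

theorem measurable_waveAverage {n : ℕ} (a R s : ℝ) :
    Measurable (waveAverage a R s : Space n → ℝ) :=
  ((measurable_profile_inner a R s).stronglyMeasurable.integral_prod_right).measurable

theorem memLp_waveAverage {n : ℕ} {a : ℝ} (ha : 0 ≤ a) (R s : ℝ) (ρ : ℝ) (r : ENNReal) :
    MemLp (waveAverage a R s) r (volume.restrict (Metric.closedBall (0 : Space n) ρ)) := by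
  have : IsFiniteMeasure (volume.restrict (Metric.closedBall (0 : Space n) ρ)) :=
    isFiniteMeasure_restrict.2 measure_closedBall_lt_top.ne
  refine MemLp.of_bound (measurable_waveAverage a R s).aestronglyMeasurable
    (2 ^ a * (volume.restrict (Metric.ball (0 : Space n) 1)).real univ) (ae_of_all _ fun x => ?_)
  rw [Real.norm_of_nonneg (waveAverage_nonneg _ _ _ _)]
  exact waveAverage_le_const ha R s x

theorem waveFunctional_rpow_le {n : ℕ} {a r : ℝ} (ha : 0 ≤ a) (hr : 1 < r) (R s ρ : ℝ)
    {g : Space n → ℝ} (hg : Integrable g) (hsupp : ∀ᵐ x, ρ < ‖x‖ → g x = 0)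
    (hgr : Integrable (fun x => |g x| ^ r)) :
    |waveFunctional a R s g| ^ r ≤
      (∫ x in Metric.closedBall (0 : Space n) ρ, waveAverage a R s x ^ (r / (r - 1))) ^ (r - 1) *
        ∫ x, |g x| ^ r := by
  have hr0 : 0 < r := by linarith
  have hr1 : 0 < r - 1 := by linarith
  have hconj : r.HolderConjugate (r / (r - 1)) := Real.HolderConjugate.conjExponent hr
  set μ := volume.restrict (Metric.closedBall (0 : Space n) ρ)
  have hgm : MemLp g (ENNReal.ofReal r) μ := by
    have : MemLp g (ENNReal.ofReal r) volume := by
      rw [← integrable_norm_rpow_iff hg.aestronglyMeasurable (by simpa using hr0) (by simp),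
        ENNReal.toReal_ofReal hr0.le]
      simpa using hgr
    exact this.restrict _
  have hH := integral_mul_norm_le_Lp_mul_Lq hconj hgm (memLp_waveAverage ha R s ρ _)
  have h1 : |waveFunctional a R s g| ≤ ∫ x, ‖g x‖ * ‖waveAverage a R s x‖ ∂μ := by
    rw [waveFunctional_eq ha R s hg, ← Real.norm_eq_abs]
    have : ∫ x, g x * waveAverage a R s x = ∫ x, g x * waveAverage a R s x ∂μ := by
      refine (setIntegral_eq_integral_of_ae_compl_eq_zero ?_).symm
      filter_upwards [hsupp] with x hx hx'
      rw [hx (by simpa using hx'), zero_mul]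
    rw [this]
    refine (norm_integral_le_integral_norm _).trans (le_of_eq ?_)
    simp_rw [norm_mul]
  have h2 : ∫ x, ‖g x‖ ^ r ∂μ ≤ ∫ x, |g x| ^ r := by
    simp_rw [Real.norm_eq_abs]
    exact setIntegral_le_integral hgr (ae_of_all _ fun x => Real.rpow_nonneg (abs_nonneg _) _)
  have h3 : ∫ x, ‖waveAverage a R s x‖ ^ (r / (r - 1)) ∂μ =
      ∫ x, waveAverage a R s x ^ (r / (r - 1)) ∂μ := by
    congr 1; ext x; rw [Real.norm_of_nonneg (waveAverage_nonneg _ _ _ _)]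
  have hn1 : 0 ≤ ∫ x, ‖g x‖ ^ r ∂μ := integral_nonneg fun _ => Real.rpow_nonneg (norm_nonneg _) _
  have hn2 : 0 ≤ ∫ x, waveAverage a R s x ^ (r / (r - 1)) ∂μ :=
    integral_nonneg fun _ => Real.rpow_nonneg (waveAverage_nonneg _ _ _ _) _
  rw [h3] at hH
  calc |waveFunctional a R s g| ^ r
      ≤ ((∫ x, ‖g x‖ ^ r ∂μ) ^ (1 / r) *
        (∫ x, waveAverage a R s x ^ (r / (r - 1)) ∂μ) ^ (1 / (r / (r - 1)))) ^ r :=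
        Real.rpow_le_rpow (abs_nonneg _) (h1.trans hH) hr0.le
    _ = (∫ x, waveAverage a R s x ^ (r / (r - 1)) ∂μ) ^ (r - 1) * ∫ x, ‖g x‖ ^ r ∂μ := by
        rw [Real.mul_rpow (by positivity) (by positivity), ← Real.rpow_mul hn1, ← Real.rpow_mul hn2,
          show 1 / r * r = 1 by field_simp, show 1 / (r / (r - 1)) * r = r - 1 by field_simp,
          Real.rpow_one, mul_comm]
    _ ≤ _ := by gcongr

theorem add_rpow_le {c : ℝ} (hc : 0 ≤ c) (e : ℝ) :
    ∀ s : ℝ, 1 ≤ s → (s + c) ^ e ≤ (1 + c) ^ |e| * s ^ e := by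
  intro s hs
  have hs0 : 0 < s := by linarith
  have h1 : s + c = (1 + c / s) * s := by field_simp
  have hcs : 0 ≤ c / s := by positivity
  have hcs' : c / s ≤ c := div_le_self hc hs
  rw [h1, Real.mul_rpow (by positivity) hs0.le]
  refine mul_le_mul_of_nonneg_right ?_ (Real.rpow_nonneg hs0.le _)
  calc (1 + c / s) ^ e ≤ (1 + c / s) ^ |e| :=
        Real.rpow_le_rpow_of_exponent_le (by linarith) (le_abs_self e)
    _ ≤ _ := Real.rpow_le_rpow (by positivity) (by linarith) (abs_nonneg _)

theorem volume_real_ball_pos (n : ℕ) : 0 < volume.real (Metric.ball (0 : Space n) 1) :=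
  ENNReal.toReal_pos (Metric.measure_ball_pos _ _ one_pos).ne' measure_ball_lt_top.ne

/-- With T = s + R + 2 and r' = r/(r-1), the decay of the average and the radial density contribute
T^(-m r' + 2m); raised to the power r - 1 this is T^(m(r-2)). For s ≥ 1 the time T is comparable to
s. -/
theorem integral_waveAverage_rpow_le {n : ℕ} (hn : 2 ≤ n) {a r R : ℝ} (hr : 1 < r) (hR : 0 < R)
    (ha : ((n : ℝ) - 1) / 2 < a) :
    ∃ C : ℝ, 0 < C ∧ ∀ s : ℝ, 1 ≤ s →
      (∫ x in Metric.closedBall (0 : Space n) (s + R + 1),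
        waveAverage a R s x ^ (r / (r - 1))) ^ (r - 1) ≤
      C * s ^ (((n : ℝ) - 1) / 2 * (r - 2)) *
        (∫ z in (1 : ℝ)..(s + R + 2), z ^ (-((a - ((n : ℝ) - 1) / 2) * (r / (r - 1))))) ^ (r - 1) := by
  obtain ⟨C, hC, hW⟩ := waveAverage_le hn ha
  have hr1 : 0 < r - 1 := by linarith
  set r' := r / (r - 1) with hr'
  have hr'0 : 0 < r' := by rw [hr']; exact div_pos (by linarith) hr1
  set V := volume.real (Metric.ball (0 : Space n) 1) with hV
  have hV0 : 0 < V := volume_real_ball_pos n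
  have hn0 : (0 : ℝ) < n := by exact_mod_cast (by omega : 0 < n)
  obtain ⟨m, hm⟩ : ∃ m, m = ((n : ℝ) - 1) / 2 := ⟨_, rfl⟩
  rw [← hm] at ha hW ⊢
  refine ⟨(C ^ r' * n * V * (1 + (R + 2)) ^ |2 * m - m * r'|) ^ (r - 1), by positivity,
    fun s hs => ?_⟩
  set T := s + R + 2 with hT
  have hT1 : 1 ≤ T := by linarith
  have hT0 : 0 < T := by linarith
  set I := ∫ z in (1 : ℝ)..T, z ^ (-((a - m) * r')) with hI
  have hI0 : 0 ≤ I := intervalIntegral.integral_nonneg hT1 fun z hz =>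
    Real.rpow_nonneg (by linarith [hz.1]) _
  obtain ⟨hint, hle⟩ := integral_ball_radial_le (n := n) (κ := (a - m) * r') (by omega) hT1
  rw [show T - 1 = s + R + 1 by rw [hT]; ring] at hint hle
  have hpt : ∀ x ∈ Metric.closedBall (0 : Space n) (s + R + 1), waveAverage a R s x ^ r' ≤
      C ^ r' * T ^ (-(m * r')) * (T - ‖x‖) ^ (-((a - m) * r')) := by
    intro x hx
    have hx' : ‖x‖ ≤ s + R + 1 := by simpa using hx
    have hz : 0 ≤ T - ‖x‖ := by linarith
    refine (Real.rpow_le_rpow (waveAverage_nonneg _ _ _ _) (hW R s x hx') hr'0.le).trans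
      (le_of_eq ?_)
    rw [← hT, Real.mul_rpow (by positivity) (by positivity), Real.mul_rpow hC.le (by positivity),
      ← Real.rpow_mul hT0.le, ← Real.rpow_mul hz]
    congr 2 <;> ring_nf
  have h1 : ∫ x in Metric.closedBall (0 : Space n) (s + R + 1), waveAverage a R s x ^ r' ≤
      C ^ r' * T ^ (-(m * r')) * (n * V * T ^ ((n : ℝ) - 1) * I) := by
    calc _ ≤ ∫ x in Metric.closedBall (0 : Space n) (s + R + 1),
          C ^ r' * T ^ (-(m * r')) * (T - ‖x‖) ^ (-((a - m) * r')) := by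
          apply integral_mono_of_nonneg
          · exact ae_of_all _ fun x => Real.rpow_nonneg (waveAverage_nonneg _ _ _ _) _
          · exact hint.const_mul _
          · exact (ae_restrict_iff' measurableSet_closedBall).2 (ae_of_all _ hpt)
      _ ≤ _ := by
          rw [integral_const_mul]
          exact mul_le_mul_of_nonneg_left hle (by positivity)
  have h2 : C ^ r' * T ^ (-(m * r')) * (n * V * T ^ ((n : ℝ) - 1) * I) ≤
      (C ^ r' * n * V * (1 + (R + 2)) ^ |2 * m - m * r'|) * s ^ (2 * m - m * r') * I := by
    have h3 : T ^ (2 * m - m * r') ≤ (1 + (R + 2)) ^ |2 * m - m * r'| * s ^ (2 * m - m * r') := by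
      rw [show T = s + (R + 2) by rw [hT]; ring]
      exact add_rpow_le (by linarith) _ s hs
    have h4 : T ^ (-(m * r')) * T ^ ((n : ℝ) - 1) = T ^ (2 * m - m * r') := by
      rw [← Real.rpow_add hT0, hm]; congr 1; ring
    have h5 := mul_le_mul_of_nonneg_left h3 (by positivity : 0 ≤ C ^ r' * n * V * I)
    rw [← h4] at h5
    linear_combination h5
  refine (Real.rpow_le_rpow (integral_nonneg fun x => Real.rpow_nonneg (waveAverage_nonneg _ _ _ _) _)
    (h1.trans h2) hr1.le).trans (le_of_eq ?_)
  have hs0 : 0 < s := by linarith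
  rw [Real.mul_rpow (by positivity) hI0, Real.mul_rpow (by positivity) (by positivity),
    ← Real.rpow_mul hs0.le]
  congr 3
  rw [hr']; field_simp; ring

/-- For a = 0 the weight is constant, so this is plain Hölder on a ball of radius comparable to s.
-/
theorem waveFunctional_zero_rpow_le (n : ℕ) {r R : ℝ} (hr : 1 < r) (hR : 0 < R) :
    ∃ C : ℝ, 0 < C ∧ ∀ s : ℝ, 1 ≤ s → ∀ g : Space n → ℝ, Integrable g →
      (∀ᵐ x, s + R + 1 < ‖x‖ → g x = 0) → Integrable (fun x => |g x| ^ r) →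
      |waveFunctional 0 R s g| ^ r ≤ C * s ^ ((n : ℝ) * (r - 1)) * ∫ x, |g x| ^ r := by
  have hr1 : 0 < r - 1 := by linarith
  set V := volume.real (Metric.ball (0 : Space n) 1) with hV
  have hV0 : 0 < V := volume_real_ball_pos n
  refine ⟨(V ^ (r / (r - 1)) * V * (1 + (R + 1)) ^ |(n : ℝ)|) ^ (r - 1), by positivity,
    fun s hs g hg hsupp hgr => ?_⟩
  have hs0 : 0 < s := by linarith
  refine (waveFunctional_rpow_le le_rfl hr R s _ hg hsupp hgr).trans
    (mul_le_mul_of_nonneg_right ?_ (integral_nonneg fun _ => Real.rpow_nonneg (abs_nonneg _) _))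
  have h1 : ∀ x : Space n, waveAverage 0 R s x = V := by
    intro x; simp [waveAverage, profile_zero, hV]
  simp_rw [h1]
  rw [setIntegral_const, smul_eq_mul, measureReal_def, Measure.addHaar_closedBall _ _ (by linarith),
    ENNReal.toReal_mul, ENNReal.toReal_ofReal (by positivity), ← measureReal_def, ← hV,
    finrank_euclideanSpace, Fintype.card_fin, Real.rpow_mul hs0.le,
    ← Real.mul_rpow (by positivity) (by positivity)]
  refine Real.rpow_le_rpow (by positivity) ?_ hr1.le
  have h2 := add_rpow_le (c := R + 1) (by linarith) n s hs
  rw [← add_assoc, Real.rpow_natCast] at h2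
  have h3 := mul_le_mul_of_nonneg_left h2 (by positivity : 0 ≤ V ^ (r / (r - 1)) * V)
  linear_combination h3

theorem waveFunctional_log_rpow_le {n : ℕ} (hn : 2 ≤ n) {r R : ℝ} (hr : 1 < r) (hR : 0 < R) :
    ∃ C : ℝ, 0 < C ∧ ∀ s : ℝ, 1 ≤ s → ∀ g : Space n → ℝ, Integrable g →
      (∀ᵐ x, s + R + 1 < ‖x‖ → g x = 0) → Integrable (fun x => |g x| ^ r) →
      |waveFunctional (((n : ℝ) - 1) / 2 + 1 - r⁻¹) R s g| ^ r ≤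
        C * s ^ (((n : ℝ) - 1) / 2 * (r - 2)) * (1 + Real.log s) ^ (r - 1) * ∫ x, |g x| ^ r := by
  have hr1 : 0 < r - 1 := by linarith
  have hrinv : r⁻¹ < 1 := inv_lt_one_of_one_lt₀ hr
  have hm : (0 : ℝ) < ((n : ℝ) - 1) / 2 := by
    have : (2 : ℝ) ≤ n := by exact_mod_cast hn
    linarith
  obtain ⟨C, hC, hJ⟩ := integral_waveAverage_rpow_le hn (a := ((n : ℝ) - 1) / 2 + 1 - r⁻¹) hr hR
    (by linarith)
  have hlogR : 0 < Real.log (R + 3) := Real.log_pos (by linarith)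
  refine ⟨C * (1 + Real.log (R + 3)) ^ (r - 1), by positivity, fun s hs g hg hsupp hgr => ?_⟩
  have hs0 : 0 < s := by linarith
  have hlog : 0 ≤ Real.log s := Real.log_nonneg hs
  refine (waveFunctional_rpow_le (by linarith) hr R s _ hg hsupp hgr).trans
    (mul_le_mul_of_nonneg_right ?_ (integral_nonneg fun _ => Real.rpow_nonneg (abs_nonneg _) _))
  refine (hJ s hs).trans ?_
  -- The choice of a makes the radial exponent exactly -1; this is where the logarithm originates.
  have h1 : -((((n : ℝ) - 1) / 2 + 1 - r⁻¹ - ((n : ℝ) - 1) / 2) * (r / (r - 1))) = -1 := by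
    field_simp; ring
  have h2 : ∫ z in (1 : ℝ)..(s + R + 2), z ^ (-1 : ℝ) = Real.log (s + R + 2) := by
    simp_rw [Real.rpow_neg_one]
    rw [integral_inv_of_pos one_pos (by linarith), div_one]
  have h3 : Real.log (s + R + 2) ≤ (1 + Real.log (R + 3)) * (1 + Real.log s) := by
    have : Real.log (s + R + 2) ≤ Real.log ((R + 3) * s) :=
      Real.log_le_log (by linarith) (by nlinarith)
    rw [Real.log_mul (by linarith) hs0.ne'] at this
    nlinarith [mul_nonneg hlogR.le hlog]
  rw [h1, h2]
  have h4 := Real.rpow_le_rpow (Real.log_nonneg (by linarith)) h3 hr1.le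
  rw [Real.mul_rpow (by positivity) (by positivity)] at h4
  have h5 := mul_le_mul_of_nonneg_left h4
    (by positivity : 0 ≤ C * s ^ (((n : ℝ) - 1) / 2 * (r - 2)))
  linear_combination h5

/-- Here the radial exponent is -r/(r-1) < -1, so the integral across the cone is bounded uniformly
in s and no logarithm appears. This version is applied to the contribution of the data. -/
theorem waveFunctional_strip_rpow_le {n : ℕ} (hn : 2 ≤ n) {r R : ℝ} (hr : 1 < r) (hR : 0 < R) :
    ∃ C : ℝ, 0 < C ∧ ∀ s : ℝ, 1 ≤ s → ∀ g : Space n → ℝ, Integrable g →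
      (∀ᵐ x, s + R + 1 < ‖x‖ → g x = 0) → Integrable (fun x => |g x| ^ r) →
      |waveFunctional (((n : ℝ) - 1) / 2 + 1) R s g| ^ r ≤
        C * s ^ (((n : ℝ) - 1) / 2 * (r - 2)) * ∫ x, |g x| ^ r := by
  have hr1 : 0 < r - 1 := by linarith
  have hm : (0 : ℝ) < ((n : ℝ) - 1) / 2 := by
    have : (2 : ℝ) ≤ n := by exact_mod_cast hn
    linarith
  obtain ⟨C, hC, hJ⟩ := integral_waveAverage_rpow_le hn (a := ((n : ℝ) - 1) / 2 + 1) hr hR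
    (by linarith)
  refine ⟨C * (r - 1) ^ (r - 1), by positivity, fun s hs g hg hsupp hgr => ?_⟩
  have hs0 : 0 < s := by linarith
  refine (waveFunctional_rpow_le (by linarith) hr R s _ hg hsupp hgr).trans
    (mul_le_mul_of_nonneg_right ?_ (integral_nonneg fun _ => Real.rpow_nonneg (abs_nonneg _) _))
  refine (hJ s hs).trans ?_
  have h1 : -((((n : ℝ) - 1) / 2 + 1 - ((n : ℝ) - 1) / 2) * (r / (r - 1))) = -(r / (r - 1)) := by
    ring
  have h2 : ∫ z in (1 : ℝ)..(s + R + 2), z ^ (-(r / (r - 1))) ≤ r - 1 := by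
    have hk : 1 < r / (r - 1) := by rw [lt_div_iff₀ hr1]; linarith
    rw [integral_rpow (Or.inr ⟨by linarith, by
      rw [uIcc_of_le (by linarith)]; intro h; linarith [h.1]⟩)]
    have h3 : -(r / (r - 1)) + 1 = -(1 / (r - 1)) := by field_simp; ring
    have h4 : 0 ≤ (s + R + 2) ^ (-(1 / (r - 1))) := Real.rpow_nonneg (by linarith) _
    rw [h3, Real.one_rpow, div_neg, ← neg_div, div_le_iff₀ (by positivity)]
    field_simp
    linarith
  rw [h1]
  have h4 := Real.rpow_le_rpow (intervalIntegral.integral_nonneg (by linarith) fun z hz =>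
    Real.rpow_nonneg (by linarith [hz.1]) _) h2 hr1.le
  have h5 := mul_le_mul_of_nonneg_left h4
    (by positivity : 0 ≤ C * s ^ (((n : ℝ) - 1) / 2 * (r - 2)))
  linear_combination h5

/-! ### Supports and integrability of time slices -/

theorem timeInterval_convex (T : EReal) : Convex ℝ (timeInterval T) := by
  rw [convex_iff_ordConnected]
  refine ⟨fun x hx y hy z hz => ⟨hx.1.trans hz.1, lt_of_le_of_lt ?_ hy.2⟩⟩
  exact_mod_cast hz.2

theorem Icc_subset_timeInterval {T : EReal} {t : ℝ} (ht : t ∈ timeInterval T) :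
    Icc 0 t ⊆ timeInterval T := fun s hs =>
  ⟨hs.1, lt_of_le_of_lt (by exact_mod_cast hs.2) ht.2⟩

theorem uniqueDiffOn_timeInterval {T : EReal} (hT : 0 < T) :
    UniqueDiffOn ℝ (timeInterval T) := by
  refine uniqueDiffOn_convex (timeInterval_convex T) ?_
  obtain ⟨t, h0, h1⟩ := EReal.lt_iff_exists_real_btwn.1 hT
  have h0' : (0 : ℝ) < t := by exact_mod_cast h0
  refine Set.Nonempty.mono (interior_mono (Icc_subset_timeInterval ⟨h0'.le, h1⟩)) ?_
  rw [interior_Icc]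
  exact nonempty_Ioo.2 h0'

/-- Pair u(s) with g, the part of ∂ₜu(t) outside the ball of radius t + R + 1. The pairing vanishes
for all s ≤ t + 1, hence so does its derivative at s = t, which is ‖g‖². The extra 1 in the radius
is the room that lets s move past t. -/
theorem supportedInBall_timeDeriv {n : ℕ} {T : EReal} {R : ℝ} {u : ℝ → L2 n ℝ} (hT : 0 < T)
    (hu : ContDiffOn ℝ 1 u (timeInterval T)) (hsupp : SupportedInCone T R u) {t : ℝ}
    (ht : t ∈ timeInterval T) : SupportedInBall (t + R + 1) (timeDeriv T u t) := by
  have hE : MeasurableSet {x : Space n | t + R + 1 < ‖x‖} :=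
    measurableSet_lt measurable_const measurable_norm
  have hd : HasDerivWithinAt u (timeDeriv T u t) (timeInterval T) t :=
    ((hu.differentiableOn one_ne_zero) t ht).hasDerivWithinAt
  have hmem := (Lp.memLp (timeDeriv T u t)).indicator hE
  set g : L2 n ℝ := hmem.toLp with hg
  have hgae : g =ᵐ[volume] {x : Space n | t + R + 1 < ‖x‖}.indicator (timeDeriv T u t) :=
    hmem.coeFn_toLp
  have hd2 : HasDerivWithinAt (fun s => innerSL ℝ g (u s)) (innerSL ℝ g (timeDeriv T u t))
      (timeInterval T) t := (innerSL ℝ g).hasFDerivAt.comp_hasDerivWithinAt t hd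
  have hzero : ∀ s ∈ timeInterval T, s ≤ t + 1 → innerSL ℝ g (u s) = 0 := by
    intro s hs hst
    rw [innerSL_apply_apply, L2.inner_def]
    refine integral_eq_zero_of_ae ?_
    filter_upwards [hgae, hsupp s hs] with x h1 h2
    rw [h1]
    by_cases hx : t + R + 1 < ‖x‖
    · rw [h2 (by linarith)]; simp
    · rw [indicator_of_notMem (by exact hx)]; simp
  have hd3 : HasDerivWithinAt (fun s => innerSL ℝ g (u s)) 0 (timeInterval T) t := by
    refine (hasDerivWithinAt_const t (timeInterval T) (0 : ℝ)).congr_of_eventuallyEq ?_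
      (hzero t ht (by linarith))
    filter_upwards [self_mem_nhdsWithin, nhdsWithin_le_nhds (Iio_mem_nhds (lt_add_one t))]
      with s h1 h2
    exact hzero s h1 (le_of_lt h2)
  have heq := (uniqueDiffOn_timeInterval hT t ht).eq_deriv _ hd2 hd3
  rw [innerSL_apply_apply, L2.inner_def] at heq
  have hsq : ∫ x, g x ^ 2 = 0 := by
    rw [← heq]
    refine integral_congr_ae ?_
    filter_upwards [hgae] with x h1
    by_cases hx : t + R + 1 < ‖x‖
    · rw [h1, indicator_of_mem (by exact hx)]; simp [pow_two]
    · rw [h1, indicator_of_notMem (by exact hx)]; simp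
  have hint : Integrable (fun x => g x ^ 2) := (Lp.memLp g).integrable_sq
  have h0 := (integral_eq_zero_iff_of_nonneg (fun x => sq_nonneg (g x)) hint).1 hsq
  filter_upwards [h0, hgae] with x h1 h2 hx
  have h3 : g x = 0 := by simpa using h1
  rwa [h2, indicator_of_mem (by exact hx)] at h3

theorem integrable_of_supportedInBall {n : ℕ} {ρ : ℝ} {f : L2 n ℝ} (hf : SupportedInBall ρ f) :
    Integrable f := by
  have h1 : IntegrableOn f (Metric.closedBall 0 ρ) := by
    have : IsFiniteMeasure (volume.restrict (Metric.closedBall (0 : Space n) ρ)) :=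
      isFiniteMeasure_restrict.2 measure_closedBall_lt_top.ne
    exact ((Lp.memLp f).restrict _).integrable (by norm_num)
  refine h1.integrable_of_ae_notMem_eq_zero ?_
  filter_upwards [hf] with x hx hx'
  exact hx (by simpa using hx')

/-- Local integrability is known only for a joint representative on compact sets. As the slices up
to time t live in a fixed ball, Fubini on a compact product transfers it to them, with continuous
weights allowed. -/
theorem slice_integrable {n : ℕ} {T : EReal} {r ρ : ℝ} (hr : 0 < r) {w : ℝ → L2 n ℝ}
    (hw : MemLpLoc r T w) {t : ℝ} (ht : t ∈ timeInterval T)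
    (hsupp : ∀ s ∈ Icc 0 t, SupportedInBall ρ (w s))
    {φ : ℝ → Space n → ℝ} (hφ : Continuous (Function.uncurry φ)) :
    (∀ᵐ s, s ∈ Ioc 0 t → Integrable (fun x => |w s x| ^ r * φ s x)) ∧
    IntervalIntegrable (fun s => ∫ x, |w s x| ^ r * φ s x) volume 0 t := by
  obtain ⟨f, hf, hK⟩ := hw
  have hKc : IsCompact (Icc 0 t ×ˢ Metric.closedBall (0 : Space n) ρ) :=
    isCompact_Icc.prod (isCompact_closedBall _ _)
  have h1 := hK _ hKc (prod_mono (Icc_subset_timeInterval ht) (subset_univ _))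
  have h2 : IntegrableOn (fun z : ℝ × Space n => |f z| ^ r)
      (Icc 0 t ×ˢ Metric.closedBall (0 : Space n) ρ) := by
    have := h1.integrable_norm_rpow (by simpa using hr) (by simp)
    rwa [ENNReal.toReal_ofReal hr.le] at this
  have h3 : IntegrableOn (fun z : ℝ × Space n => |f z| ^ r * φ z.1 z.2)
      (Icc 0 t ×ˢ Metric.closedBall (0 : Space n) ρ) := h2.mul_continuousOn hφ.continuousOn hKc
  rw [IntegrableOn, Measure.volume_eq_prod, ← Measure.prod_restrict] at h3
  have hslice : ∀ s ∈ Icc 0 t, (fun x => |w s x| ^ r * φ s x) =ᵐ[volume]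
      (Metric.closedBall (0 : Space n) ρ).indicator (fun x => |f (s, x)| ^ r * φ s x) := by
    intro s hs
    filter_upwards [hf s (Icc_subset_timeInterval ht hs), hsupp s hs] with x hx1 hx2
    by_cases hx : ρ < ‖x‖
    · rw [hx2 hx, indicator_of_notMem (by simpa using hx), abs_zero, Real.zero_rpow hr.ne', zero_mul]
    · rw [indicator_of_mem (by simpa using hx), hx1]
  constructor
  · have h4 := h3.prod_right_ae
    rw [ae_restrict_iff' measurableSet_Icc] at h4
    filter_upwards [h4] with s hs hs'
    have hs'' := Ioc_subset_Icc_self hs'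
    exact ((integrable_indicator_iff measurableSet_closedBall).2 (hs hs'')).congr (hslice s hs'').symm
  · rw [intervalIntegrable_iff_integrableOn_Icc_of_le ht.1]
    refine (h3.integral_prod_left).congr ?_
    rw [Filter.EventuallyEq, ae_restrict_iff' measurableSet_Icc]
    refine ae_of_all _ fun s hs => ?_
    rw [integral_congr_ae (hslice s hs), integral_indicator measurableSet_closedBall]

/-! ### Plane waves as test functions -/

theorem hasDerivAt_planeWave {h₁ h₂ : ℝ → ℝ} (d₁ : Differentiable ℝ h₁) (d₂ : Differentiable ℝ h₂)
    (c s : ℝ) : HasDerivAt (fun s => h₁ (s - c) + h₂ (-s - c))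
      (deriv h₁ (s - c) - deriv h₂ (-s - c)) s := by
  have e1 : HasDerivAt (fun s : ℝ => s - c) 1 s := (hasDerivAt_id s).sub_const c
  have e2 : HasDerivAt (fun s : ℝ => -s - c) (-1) s := (hasDerivAt_neg s).sub_const c
  have := ((d₁ (s - c)).hasDerivAt.comp s e1).add ((d₂ (-s - c)).hasDerivAt.comp s e2)
  refine this.congr_deriv (by ring)

theorem iteratedDeriv_two_planeWave {h₁ h₂ : ℝ → ℝ} (d₁ : ContDiff ℝ ∞ h₁) (d₂ : ContDiff ℝ ∞ h₂)
    (c s : ℝ) : iteratedDeriv 2 (fun s => h₁ (s - c) + h₂ (-s - c)) s =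
      deriv (deriv h₁) (s - c) + deriv (deriv h₂) (-s - c) := by
  rw [iteratedDeriv_succ, iteratedDeriv_one]
  have e : deriv (fun s => h₁ (s - c) + h₂ (-s - c)) =
      fun s => deriv h₁ (s - c) + (-deriv h₂) (-s - c) := by
    ext s
    rw [(hasDerivAt_planeWave (d₁.differentiable (by simp)) (d₂.differentiable (by simp)) c s).deriv]
    simp [sub_eq_add_neg]
  have h2 := hasDerivAt_planeWave (h₂ := -deriv h₂)
    ((contDiff_infty_iff_deriv.1 d₁).2.differentiable (by simp))
    ((contDiff_infty_iff_deriv.1 d₂).2.neg.differentiable (by simp)) c s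
  rw [e, h2.deriv, deriv.neg]
  ring

/-- Each second directional derivative is H'' times the squared coordinate of e, and those squares
add up to ‖e‖² = 1. -/
theorem laplacian_ridge {n : ℕ} {H : ℝ → ℝ} (hH : ContDiff ℝ 2 H) {e : Space n} (he : ‖e‖ = 1)
    (x : Space n) : Laplacian.laplacian (fun x => H (inner ℝ e x)) x =
      deriv (deriv H) (inner ℝ e x) := by
  rw [InnerProductSpace.laplacian_eq_iteratedFDeriv_stdOrthonormalBasis]
  have h1 : (fun x => H (inner ℝ e x)) = H ∘ (innerSL ℝ e) := by ext; simp
  simp only [h1]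
  rw [ContinuousLinearMap.iteratedFDeriv_comp_right _ hH x (i := 2) le_rfl]
  have h2 : ∀ v : Space n, ((iteratedFDeriv ℝ 2 H (innerSL ℝ e x)).compContinuousLinearMap
      fun _ => innerSL ℝ e) ![v, v] = inner ℝ e v ^ 2 * deriv (deriv H) (inner ℝ e x) := by
    intro v
    rw [ContinuousMultilinearMap.compContinuousLinearMap_apply, iteratedFDeriv_apply_eq_iteratedDeriv_mul_prod,
      iteratedDeriv_succ, iteratedDeriv_one]
    simp [Fin.prod_univ_two, pow_two]
  simp only [h2]
  rw [← Finset.sum_mul, (stdOrthonormalBasis ℝ (Space n)).sum_sq_inner_left, he]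
  simp

/-- A superposition of two plane waves travelling in the direction `e` and in its opposite. -/
noncomputable def planeWave {n : ℕ} (h₁ h₂ : ℝ → ℝ) (e : Space n) (s : ℝ) (x : Space n) : ℝ :=
  h₁ (s - inner ℝ x e) + h₂ (-s - inner ℝ x e)

theorem planeWave_contDiff {n : ℕ} {h₁ h₂ : ℝ → ℝ} (d₁ : ContDiff ℝ ∞ h₁) (d₂ : ContDiff ℝ ∞ h₂)
    (e : Space n) : ContDiff ℝ ∞ (Function.uncurry (planeWave h₁ h₂ e)) := by
  unfold Function.uncurry planeWave
  exact (d₁.comp (contDiff_fst.sub (contDiff_snd.inner ℝ contDiff_const))).add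
    (d₂.comp (contDiff_fst.neg.sub (contDiff_snd.inner ℝ contDiff_const)))

theorem laplacian_planeWave {n : ℕ} {h₁ h₂ : ℝ → ℝ} (d₁ : ContDiff ℝ ∞ h₁) (d₂ : ContDiff ℝ ∞ h₂)
    {e : Space n} (he : ‖e‖ = 1) (s : ℝ) (x : Space n) :
    Laplacian.laplacian (planeWave h₁ h₂ e s) x =
      iteratedDeriv 2 (fun s => planeWave h₁ h₂ e s x) s := by
  have hH : ContDiff ℝ ∞ (fun z => h₁ (s - z) + h₂ (-s - z)) := by
    exact (d₁.comp (contDiff_const.sub contDiff_id)).add (d₂.comp (contDiff_const.sub contDiff_id))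
  have e1 : planeWave h₁ h₂ e s = fun x => (fun z => h₁ (s - z) + h₂ (-s - z)) (inner ℝ e x) := by
    ext x; simp only [planeWave, real_inner_comm]
  unfold planeWave at e1 ⊢
  rw [e1, laplacian_ridge (hH.of_le ENat.LEInfty.out) he, iteratedDeriv_two_planeWave d₁ d₂]
  have h3 : (fun z => h₁ (s - z) + h₂ (-s - z)) =
      fun z => (fun y => h₁ (-y)) (z - s) + h₂ (-z - s) := by
    ext z
    simp only [neg_sub, show -s - z = -z - s by ring]
  have h4 : deriv (deriv fun y => h₁ (-y)) = fun y => deriv (deriv h₁) (-y) := by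
    ext y
    have := iteratedDeriv_comp_neg 2 h₁ y
    simpa [iteratedDeriv_succ, iteratedDeriv_one] using this
  have h5 := iteratedDeriv_two_planeWave (d₁.comp contDiff_neg) d₂ s (inner ℝ e x)
  rw [iteratedDeriv_succ, iteratedDeriv_one] at h5
  rw [h3]
  refine h5.trans ?_
  have h6 := congrFun h4 (inner ℝ e x - s)
  rw [real_inner_comm x e, show -s - inner ℝ x e = -inner ℝ x e - s by ring]
  rw [real_inner_comm x e, neg_sub] at h6
  rw [← h6]
  rfl

/-- Plane waves are not compactly supported, but a cutoff equal to 1 near the part of the cone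
between times 0 and t changes none of the integrals. The bulk term then disappears, since plane
waves solve the free equation. -/
theorem weakWaveIdentity_planeWave {n : ℕ} {T : EReal} {ε R : ℝ} {w₀ w₁ : L2 n ℝ}
    {w wt : ℝ → L2 n ℝ} {F : ℝ → Space n → ℝ} {t : ℝ} (ht : t ∈ timeInterval T)
    (hw₀ : SupportedInBall R w₀) (hw₁ : SupportedInBall R w₁)
    (hw : ∀ s ∈ timeInterval T, SupportedInBall (s + R + 1) (w s))
    (hwt : ∀ s ∈ timeInterval T, SupportedInBall (s + R + 1) (wt s))
    (hF : ∀ s ∈ timeInterval T, ∀ᵐ x, s + R + 1 < ‖x‖ → F s x = 0)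
    (hid : ∀ φ : ℝ → Space n → ℝ, IsTestFunction T φ → WeakWaveIdentity ε w₀ w₁ w wt F φ t)
    (hR : 0 < R) {h₁ h₂ : ℝ → ℝ} (d₁ : ContDiff ℝ ∞ h₁) (d₂ : ContDiff ℝ ∞ h₂)
    {e : Space n} (he : ‖e‖ = 1) :
    (∫ x, (wt t x * planeWave h₁ h₂ e t x -
        w t x * (deriv h₁ (t - inner ℝ x e) - deriv h₂ (-t - inner ℝ x e))))
      - ε * (∫ x, (w₁ x * planeWave h₁ h₂ e 0 x -
        w₀ x * (deriv h₁ (0 - inner ℝ x e) - deriv h₂ (-0 - inner ℝ x e))))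
    = ∫ s in (0 : ℝ)..t, ∫ x, F s x * planeWave h₁ h₂ e s x := by
  obtain ⟨t₂, h0, h1⟩ := EReal.lt_iff_exists_real_btwn.1 ht.2
  have htt₂ : t < t₂ := by exact_mod_cast h0
  obtain ⟨t₁, htt₁, ht₁⟩ := exists_between htt₂
  have ht0 : 0 ≤ t := ht.1
  -- Since t < T there is room for t < t₁ < t₂ < T; both cutoffs equal 1 on a neighbourhood of the
  -- region used, so derivatives agree there as well.
  let χ : ContDiffBump (0 : ℝ) := ⟨t₁, t₂, by linarith, ht₁⟩
  let η : ContDiffBump (0 : Space n) := ⟨t + R + 2, t + R + 3, by linarith, by linarith⟩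
  set φ : ℝ → Space n → ℝ := fun s x => χ s * η x * planeWave h₁ h₂ e s x with hφ
  have hpw := planeWave_contDiff d₁ d₂ e
  have hsupp : tsupport (Function.uncurry φ) ⊆
      Metric.closedBall (0 : ℝ) t₂ ×ˢ Metric.closedBall (0 : Space n) (t + R + 3) := by
    refine closure_minimal ?_ (Metric.isClosed_closedBall.prod Metric.isClosed_closedBall)
    rintro ⟨s, x⟩ hz
    have hz' : χ s * η x * planeWave h₁ h₂ e s x ≠ 0 := hz
    constructor
    · by_contra hs
      have : χ s = 0 := χ.zero_of_le_dist (not_le.1 hs).le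
      simp [this] at hz'
    · by_contra hs
      have : η x = 0 := η.zero_of_le_dist (not_le.1 hs).le
      simp [this] at hz'
  have htest : IsTestFunction T φ := by
    refine ⟨?_, ?_, ?_⟩
    · exact ((χ.contDiff.comp contDiff_fst).mul (η.contDiff.comp contDiff_snd)).mul hpw
    · exact HasCompactSupport.intro' ((isCompact_closedBall _ _).prod (isCompact_closedBall _ _))
        ((Metric.isClosed_closedBall.prod Metric.isClosed_closedBall))
        (fun z hz => by_contra fun h => hz (hsupp (subset_tsupport _ h)))
    · intro z hz
      have := (hsupp hz).1
      rw [Metric.mem_closedBall, dist_zero_right, Real.norm_eq_abs] at this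
      exact lt_of_le_of_lt (by exact_mod_cast (le_abs_self _).trans this) h1
  have hχ : ∀ s ∈ Icc 0 t, ∀ᶠ τ in 𝓝 s, χ τ = 1 := by
    intro s hs
    have : s ∈ Metric.ball (0 : ℝ) χ.rIn := by
      rw [Metric.mem_ball, dist_zero_right, Real.norm_of_nonneg hs.1]
      exact lt_of_le_of_lt hs.2 htt₁
    exact χ.eventuallyEq_one_of_mem_ball this
  have hη : ∀ x : Space n, ‖x‖ ≤ t + R + 1 → ∀ᶠ y in 𝓝 x, η y = 1 := by
    intro x hx
    have : x ∈ Metric.ball (0 : Space n) η.rIn := by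
      rw [Metric.mem_ball, dist_zero_right]
      exact lt_of_le_of_lt hx (show t + R + 1 < t + R + 2 by linarith)
    exact η.eventuallyEq_one_of_mem_ball this
  have hφeq : ∀ s ∈ Icc 0 t, ∀ x : Space n, ‖x‖ ≤ t + R + 1 → φ s x = planeWave h₁ h₂ e s x := by
    intro s hs x hx
    simp [hφ, (hχ s hs).self_of_nhds, (hη x hx).self_of_nhds]
  have hφt : ∀ s ∈ Icc 0 t, ∀ x : Space n, ‖x‖ ≤ t + R + 1 →
      (fun τ => φ τ x) =ᶠ[𝓝 s] fun τ => planeWave h₁ h₂ e τ x := by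
    intro s hs x hx
    filter_upwards [hχ s hs] with τ hτ
    simp [hφ, hτ, (hη x hx).self_of_nhds]
  have hφx : ∀ s ∈ Icc 0 t, ∀ x : Space n, ‖x‖ ≤ t + R + 1 →
      φ s =ᶠ[𝓝 x] planeWave h₁ h₂ e s := by
    intro s hs x hx
    filter_upwards [hη x hx] with y hy
    simp [hφ, hy, (hχ s hs).self_of_nhds]
  have hderiv : ∀ s ∈ Icc 0 t, ∀ x : Space n, ‖x‖ ≤ t + R + 1 → deriv (fun τ => φ τ x) s =
      deriv h₁ (s - inner ℝ x e) - deriv h₂ (-s - inner ℝ x e) := by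
    intro s hs x hx
    rw [(hφt s hs x hx).deriv_eq]
    exact (hasDerivAt_planeWave (d₁.differentiable (by simp)) (d₂.differentiable (by simp)) _ s).deriv
  have hwave : ∀ s ∈ Icc 0 t, ∀ x : Space n, ‖x‖ ≤ t + R + 1 →
      iteratedDeriv 2 (fun τ => φ τ x) s - Laplacian.laplacian (φ s) x = 0 := by
    intro s hs x hx
    rw [(hφt s hs x hx).iteratedDeriv_eq,
      (InnerProductSpace.laplacian_congr_nhds (hφx s hs x hx)).self_of_nhds,
      laplacian_planeWave d₁ d₂ he, sub_self]
  have h0t : (0 : ℝ) ∈ Icc 0 t := ⟨le_rfl, ht0⟩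
  have htt : t ∈ Icc 0 t := ⟨ht0, le_rfl⟩
  have key := hid φ htest
  unfold WeakWaveIdentity at key
  have k1 : ∫ x, (wt t x * φ t x - w t x * deriv (fun s => φ s x) t) =
      ∫ x, (wt t x * planeWave h₁ h₂ e t x -
        w t x * (deriv h₁ (t - inner ℝ x e) - deriv h₂ (-t - inner ℝ x e))) := by
    refine integral_congr_ae ?_
    filter_upwards [hw t ht, hwt t ht] with x hx1 hx2
    rcases le_or_gt ‖x‖ (t + R + 1) with hx | hx
    · rw [hφeq t htt x hx, hderiv t htt x hx]
    · rw [hx1 hx, hx2 hx]; simp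
  have k2 : ∫ x, (w₁ x * φ 0 x - w₀ x * deriv (fun s => φ s x) 0) =
      ∫ x, (w₁ x * planeWave h₁ h₂ e 0 x -
        w₀ x * (deriv h₁ (0 - inner ℝ x e) - deriv h₂ (-0 - inner ℝ x e))) := by
    refine integral_congr_ae ?_
    filter_upwards [hw₀, hw₁] with x hx1 hx2
    rcases le_or_gt ‖x‖ R with hx | hx
    · rw [hφeq 0 h0t x (by linarith), hderiv 0 h0t x (by linarith)]
    · rw [hx1 hx, hx2 hx]; simp
  have k3 : ∫ s in (0 : ℝ)..t, ∫ x,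
      w s x * (iteratedDeriv 2 (fun τ => φ τ x) s - Laplacian.laplacian (φ s) x) = 0 := by
    refine intervalIntegral.integral_zero_ae (ae_of_all _ fun s hs => ?_)
    rw [uIoc_of_le ht0] at hs
    have hs' := Ioc_subset_Icc_self hs
    refine integral_eq_zero_of_ae ?_
    filter_upwards [hw s (Icc_subset_timeInterval ht hs')] with x hx1
    rcases le_or_gt ‖x‖ (s + R + 1) with hx | hx
    · rw [hwave s hs' x (by linarith [hs.2]), mul_zero]; rfl
    · rw [hx1 hx, zero_mul]; rfl
  have k4 : ∫ s in (0 : ℝ)..t, ∫ x, F s x * φ s x =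
      ∫ s in (0 : ℝ)..t, ∫ x, F s x * planeWave h₁ h₂ e s x := by
    refine intervalIntegral.integral_congr fun s hs => ?_
    rw [uIcc_of_le ht0] at hs
    refine integral_congr_ae ?_
    filter_upwards [hF s (Icc_subset_timeInterval ht hs)] with x hx1
    rcases le_or_gt ‖x‖ (s + R + 1) with hx | hx
    · rw [hφeq s hs x (by linarith [hs.2])]
    · rw [hx1 hx, zero_mul, zero_mul]
  rw [k1, k2, k3, k4, add_zero] at key
  exact key

/-! ### Waves driven by a power source -/

/-- `w` is a weak solution of `w_tt - Δw = |g|^r` with nonnegative data `ε (w₀, w₁)`, where `wt`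
plays the role of `∂ₜw`, and all functions are supported in a light cone. -/
structure IsSourcedWave {n : ℕ} (T : EReal) (ε R : ℝ) (w₀ w₁ : L2 n ℝ) (w wt : ℝ → L2 n ℝ)
    (r : ℝ) (g : ℝ → L2 n ℝ) : Prop where
  supp : ∀ s ∈ timeInterval T, SupportedInBall (s + R + 1) (w s)
  supp_deriv : ∀ s ∈ timeInterval T, SupportedInBall (s + R + 1) (wt s)
  supp_source : ∀ s ∈ timeInterval T, SupportedInBall (s + R + 1) (g s)
  supp_pos : SupportedInBall R w₀
  supp_vel : SupportedInBall R w₁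
  pos_nonneg : ∀ᵐ x, 0 ≤ w₀ x
  vel_nonneg : ∀ᵐ x, 0 ≤ w₁ x
  eps_pos : 0 < ε
  radius_pos : 0 < R
  exponent : 1 < r
  source_loc : MemLpLoc r T g
  eq : ∀ φ : ℝ → Space n → ℝ, IsTestFunction T φ → ∀ t ∈ timeInterval T,
    WeakWaveIdentity ε w₀ w₁ w wt (fun s x => |g s x| ^ r) φ t

theorem integrable_mul_of_supportedInBall {n : ℕ} {ρ : ℝ} {f : L2 n ℝ} (hf : SupportedInBall ρ f)
    {φ : Space n → ℝ} (hφ : Continuous φ) : Integrable (fun x => f x * φ x) := by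
  have h1 := (integrable_of_supportedInBall hf).integrableOn.mul_continuousOn hφ.continuousOn
    (isCompact_closedBall (0 : Space n) ρ)
  refine h1.integrable_of_ae_notMem_eq_zero ?_
  filter_upwards [hf] with x hx hx'
  rw [hx (by simpa using hx'), zero_mul]

namespace IsSourcedWave

variable {n : ℕ} {T : EReal} {ε R r : ℝ} {w₀ w₁ : L2 n ℝ} {w wt g : ℝ → L2 n ℝ}

theorem identity (h : IsSourcedWave T ε R w₀ w₁ w wt r g) {t : ℝ} (ht : t ∈ timeInterval T)
    {h₁ h₂ : ℝ → ℝ} (d₁ : ContDiff ℝ ∞ h₁) (d₂ : ContDiff ℝ ∞ h₂) {e : Space n} (he : ‖e‖ = 1) :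
    (∫ x, (wt t x * planeWave h₁ h₂ e t x -
        w t x * (deriv h₁ (t - inner ℝ x e) - deriv h₂ (-t - inner ℝ x e))))
      - ε * (∫ x, (w₁ x * planeWave h₁ h₂ e 0 x -
        w₀ x * (deriv h₁ (0 - inner ℝ x e) - deriv h₂ (-0 - inner ℝ x e))))
    = ∫ s in (0 : ℝ)..t, ∫ x, |g s x| ^ r * planeWave h₁ h₂ e s x := by
  have hr0 : 0 < r := one_pos.trans h.exponent
  refine weakWaveIdentity_planeWave ht h.supp_pos h.supp_vel h.supp h.supp_deriv
    (fun s hs => ?_) (fun φ hφ => h.eq φ hφ t ht) h.radius_pos d₁ d₂ he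
  filter_upwards [h.supp_source s hs] with x hx hx'
  rw [hx hx', abs_zero, Real.zero_rpow hr0.ne']

theorem slice (h : IsSourcedWave T ε R w₀ w₁ w wt r g) {t : ℝ} (ht : t ∈ timeInterval T)
    {φ : ℝ → Space n → ℝ} (hφ : Continuous (Function.uncurry φ)) :
    (∀ᵐ s, s ∈ Ioc 0 t → Integrable (fun x => |g s x| ^ r * φ s x)) ∧
    IntervalIntegrable (fun s => ∫ x, |g s x| ^ r * φ s x) volume 0 t := by
  refine slice_integrable (one_pos.trans h.exponent) h.source_loc ht (ρ := t + R + 1)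
    (fun s hs => ?_) hφ
  filter_upwards [h.supp_source s (Icc_subset_timeInterval ht hs)] with x hx hx'
  exact hx (by linarith [hs.2])

theorem slice_one (h : IsSourcedWave T ε R w₀ w₁ w wt r g) {t : ℝ} (ht : t ∈ timeInterval T) :
    (∀ᵐ s, s ∈ Ioc 0 t → Integrable (fun x => |g s x| ^ r)) ∧
    IntervalIntegrable (fun s => ∫ x, |g s x| ^ r) volume 0 t := by
  simpa using h.slice ht (φ := fun _ _ => 1) continuous_const

/-- The source is nonnegative and vanishes outside the enlarged cone, so sign and lower bounds of φ
are needed only there, and times outside [α, β] may be discarded. -/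
theorem integral_le_source (h : IsSourcedWave T ε R w₀ w₁ w wt r g) {t α β : ℝ}
    (ht : t ∈ timeInterval T) (hα : 0 ≤ α) (hαβ : α ≤ β) (hβ : β ≤ t)
    {φ : ℝ → Space n → ℝ} (hφ : Continuous (Function.uncurry φ))
    (hφ0 : ∀ s ∈ Icc 0 t, ∀ x : Space n, ‖x‖ ≤ s + R + 1 → 0 ≤ φ s x) {k : ℝ → ℝ}
    (hk : ContinuousOn k (Icc α β))
    (hkφ : ∀ s ∈ Icc α β, ∀ x : Space n, ‖x‖ ≤ s + R + 1 → k s ≤ φ s x) :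
    ∫ s in α..β, k s * ∫ x, |g s x| ^ r ≤ ∫ s in (0 : ℝ)..t, ∫ x, |g s x| ^ r * φ s x := by
  have hr0 : 0 < r := one_pos.trans h.exponent
  obtain ⟨hi1, hi2⟩ := h.slice ht hφ
  obtain ⟨hj1, hj2⟩ := h.slice_one ht
  have hzero : ∀ s ∈ Icc 0 t, ∀ᵐ x, s + R + 1 < ‖x‖ → |g s x| ^ r = 0 := by
    intro s hs
    filter_upwards [h.supp_source s (Icc_subset_timeInterval ht hs)] with x hx hx'
    rw [hx hx', abs_zero, Real.zero_rpow hr0.ne']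
  have hsub : uIcc α β ⊆ uIcc 0 t := by
    rw [uIcc_of_le hαβ, uIcc_of_le ht.1]
    exact Icc_subset_Icc hα hβ
  have hmono : ∫ s in α..β, ∫ x, |g s x| ^ r * φ s x ≤
      ∫ s in (0 : ℝ)..t, ∫ x, |g s x| ^ r * φ s x := by
    refine intervalIntegral.integral_mono_interval hα hαβ hβ ?_ hi2
    refine (ae_restrict_iff' measurableSet_Ioc).2 (ae_of_all _ fun s hs => ?_)
    have hs' := Ioc_subset_Icc_self hs
    refine integral_nonneg_of_ae ?_
    filter_upwards [hzero s hs'] with x hx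
    rcases le_or_gt ‖x‖ (s + R + 1) with h1 | h1
    · exact mul_nonneg (Real.rpow_nonneg (abs_nonneg _) _) (hφ0 s hs' x h1)
    · rw [hx h1, zero_mul]; rfl
  refine le_trans ?_ hmono
  refine intervalIntegral.integral_mono_ae_restrict hαβ
    ((hj2.mono_set hsub).continuousOn_mul (by rwa [uIcc_of_le hαβ])) (hi2.mono_set hsub) ?_
  rw [← restrict_Ioc_eq_restrict_Icc]
  rw [Filter.EventuallyLE, ae_restrict_iff' measurableSet_Ioc]
  filter_upwards [hi1, hj1] with s hs1 hs2 hs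
  have hs0 : s ∈ Ioc 0 t := ⟨lt_of_le_of_lt hα hs.1, hs.2.trans hβ⟩
  have hs' := Ioc_subset_Icc_self hs
  rw [← integral_const_mul]
  refine integral_mono_ae ((hs2 hs0).const_mul _) (hs1 hs0) ?_
  filter_upwards [hzero s (Ioc_subset_Icc_self hs0)] with x hx
  rcases le_or_gt ‖x‖ (s + R + 1) with h1 | h1
  · show k s * |g s x| ^ r ≤ |g s x| ^ r * φ s x
    rw [mul_comm]
    exact mul_le_mul_of_nonneg_left (hkφ s hs' x h1) (Real.rpow_nonneg (abs_nonneg _) _)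
  · simp [hx h1]

end IsSourcedWave

/-! ### Lower bounds for plane wave moments -/

theorem le_profile {a R z b : ℝ} (ha : 0 ≤ a) (hz : -R - 1 ≤ z) (hb : z + R + 2 ≤ b) :
    b ^ (-a) ≤ profile a R z := by
  rw [profile_of_le hz]
  exact Real.rpow_le_rpow_of_nonpos (by linarith) hb (by linarith)

theorem deriv_profile {a R z : ℝ} (hz : -R - 1 < z) :
    deriv (profile a R) z = -a * (z + R + 2) ^ (-a - 1) := by
  have h1 : profile a R =ᶠ[𝓝 z] fun z => (z + R + 2) ^ (-a) := by
    filter_upwards [Ioi_mem_nhds hz] with y hy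
    exact profile_of_le (le_of_lt hy)
  rw [h1.deriv_eq]
  have h2 : HasDerivAt (fun z : ℝ => z + R + 2) 1 z :=
    ((hasDerivAt_id z).add_const R).add_const 2
  have := h2.rpow_const (p := -a) (Or.inl (by linarith))
  rw [this.deriv]; ring

theorem deriv_profile_mono {a R z z' : ℝ} (ha : 0 ≤ a) (hz : -R - 1 < z) (hzz' : z ≤ z') :
    deriv (profile a R) z ≤ deriv (profile a R) z' := by
  rw [deriv_profile hz, deriv_profile (hz.trans_le hzz')]
  have := Real.rpow_le_rpow_of_nonpos (by linarith : 0 < z + R + 2)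
    (by linarith : z + R + 2 ≤ z' + R + 2) (by linarith : -a - 1 ≤ 0)
  nlinarith

/-- A primitive of the profile. -/
noncomputable def profilePrimitive (a R z : ℝ) : ℝ := ∫ y in (0 : ℝ)..z, profile a R y

theorem hasDerivAt_profilePrimitive (a R z : ℝ) :
    HasDerivAt (profilePrimitive a R) (profile a R z) z :=
  intervalIntegral.integral_hasDerivAt_right ((profile_contDiff a R).continuous.intervalIntegrable _ _)
    ((profile_contDiff a R).continuous.stronglyMeasurableAtFilter _ _)
    (profile_contDiff a R).continuous.continuousAt

theorem deriv_profilePrimitive (a R : ℝ) : deriv (profilePrimitive a R) = profile a R := by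
  ext z; exact (hasDerivAt_profilePrimitive a R z).deriv

theorem profilePrimitive_contDiff (a R : ℝ) : ContDiff ℝ ∞ (profilePrimitive a R) := by
  rw [contDiff_infty_iff_deriv, deriv_profilePrimitive]
  exact ⟨fun z => (hasDerivAt_profilePrimitive a R z).differentiableAt, profile_contDiff a R⟩

theorem profilePrimitive_mono (a R : ℝ) : Monotone (profilePrimitive a R) :=
  monotone_of_deriv_nonneg (fun z => (hasDerivAt_profilePrimitive a R z).differentiableAt)
    fun z => by rw [deriv_profilePrimitive]; exact (profile_pos _ _ _).le

theorem mul_le_profilePrimitive_sub {a R z l b : ℝ} (ha : 0 ≤ a) (hl : 0 ≤ l) (hz : -R - 1 ≤ z)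
    (hb : z + l + R + 2 ≤ b) :
    l * b ^ (-a) ≤ profilePrimitive a R (z + l) - profilePrimitive a R z := by
  have hc : Continuous (profile a R) := (profile_contDiff a R).continuous
  unfold profilePrimitive
  rw [intervalIntegral.integral_interval_sub_left (hc.intervalIntegrable _ _)
    (hc.intervalIntegrable _ _)]
  have : ∫ _ in z..(z + l), b ^ (-a) = l * b ^ (-a) := by simp
  rw [← this]
  refine intervalIntegral.integral_mono_on (by linarith) (by simp) (hc.intervalIntegrable _ _)
    fun y hy => le_profile ha (hz.trans hy.1) (by linarith [hy.2])

theorem inner_le_of_unit {n : ℕ} {e : Space n} (he : ‖e‖ = 1) (x : Space n) :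
    |inner ℝ x e| ≤ ‖x‖ := by
  simpa [he] using abs_real_inner_le_norm x e

namespace IsSourcedWave

variable {n : ℕ} {T : EReal} {ε R r : ℝ} {w₀ w₁ : L2 n ℝ} {w wt g : ℝ → L2 n ℝ}

/-- The moments of `∂ₜw` against a plane wave dominate the contributions of the data and of
the source. -/
theorem velocity_moment_ge (h : IsSourcedWave T ε R w₀ w₁ w wt r g) {t a : ℝ}
    (ht : t ∈ timeInterval T) (ha : 0 ≤ a) {e : Space n} (he : ‖e‖ = 1) :
    ε * ((1 / 2) * (2 * R + 2) ^ (-a) * ∫ x, w₁ x) ≤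
      ∫ x, wt t x * profile a R (t - inner ℝ x e) ∧
    (1 ≤ t → (1 / 2) * (2 * R + 5) ^ (-a) * ∫ s in (1 : ℝ)..t, s ^ (-a) * ∫ x, |g s x| ^ r ≤
      ∫ x, wt t x * profile a R (t - inner ℝ x e)) := by
  have hR := h.radius_pos
  have ht0 : 0 ≤ t := ht.1
  set f := profile a R with hf
  have hfs : ContDiff ℝ ∞ f := profile_contDiff a R
  -- The test wave is ½ f(s - ⟨x, e⟩) + ½ f(2t - s - ⟨x, e⟩), even about s = t: there its time
  -- derivative vanishes and its value is f(t - ⟨x, e⟩), so only ∂ₜw is left.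
  have d₁ : ContDiff ℝ ∞ (fun z => 1 / 2 * f z) := contDiff_const.mul hfs
  have d₂ : ContDiff ℝ ∞ (fun z => 1 / 2 * f (2 * t + z)) :=
    contDiff_const.mul (hfs.comp (contDiff_const.add contDiff_id))
  have hfd : Differentiable ℝ f := hfs.differentiable (by simp)
  have e₁ : deriv (fun z => 1 / 2 * f z) = fun z => 1 / 2 * deriv f z := by
    ext z; rw [deriv_const_mul _ (hfd z)]
  have e₂ : deriv (fun z => 1 / 2 * f (2 * t + z)) = fun z => 1 / 2 * deriv f (2 * t + z) := by
    ext z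
    exact (((hfd (2 * t + z)).hasDerivAt.comp_const_add (2 * t) z).const_mul (1 / 2)).deriv
  have key := h.identity ht d₁ d₂ he
  set P := planeWave (fun z => 1 / 2 * f z) (fun z => 1 / 2 * f (2 * t + z)) e with hP
  have hPeq : ∀ s x, P s x = 1 / 2 * f (s - inner ℝ x e) + 1 / 2 * f (2 * t - s - inner ℝ x e) := by
    intro s x; simp only [hP, planeWave]; congr 3; ring
  have hPge : ∀ s x, 1 / 2 * f (s - inner ℝ x e) ≤ P s x := by
    intro s x; rw [hPeq]; linarith [profile_pos a R (2 * t - s - inner ℝ x e)]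
  have hPpos : ∀ s x, 0 ≤ P s x := fun s x => by
    linarith [hPge s x, profile_pos a R (s - inner ℝ x e)]
  have hPc : Continuous (Function.uncurry P) := (planeWave_contDiff d₁ d₂ e).continuous
  have hfc : Continuous f := hfs.continuous
  have hP0 : Continuous (P 0) := by rw [funext (hPeq 0)]; fun_prop
  rw [e₁, e₂] at key
  have k1 : ∫ x, (wt t x * P t x - w t x * (1 / 2 * deriv f (t - inner ℝ x e) -
      1 / 2 * deriv f (2 * t + (-t - inner ℝ x e)))) = ∫ x, wt t x * f (t - inner ℝ x e) := by
    congr 1; ext x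
    rw [hPeq, show 2 * t + (-t - inner ℝ x e) = t - inner ℝ x e by ring,
      show 2 * t - t - inner ℝ x e = t - inner ℝ x e by ring]
    ring
  have hfd' : Continuous (deriv f) := (contDiff_infty_iff_deriv.1 hfs).2.continuous
  have k2 : (1 / 2) * (2 * R + 2) ^ (-a) * ∫ x, w₁ x ≤
      ∫ x, (w₁ x * P 0 x - w₀ x * (1 / 2 * deriv f (0 - inner ℝ x e) -
        1 / 2 * deriv f (2 * t + (-0 - inner ℝ x e)))) := by
    rw [← integral_const_mul]
    have hB : Continuous fun x : Space n => (1 / 2 * deriv f (0 - inner ℝ x e) -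
        1 / 2 * deriv f (2 * t + (-0 - inner ℝ x e))) := by
      fun_prop
    have i1 := integrable_mul_of_supportedInBall h.supp_vel
      (φ := P 0) hP0
    have i2 := integrable_mul_of_supportedInBall h.supp_pos hB
    refine integral_mono_ae ((integrable_of_supportedInBall h.supp_vel).const_mul _)
      (i1.sub i2) ?_
    filter_upwards [h.supp_pos, h.supp_vel, h.pos_nonneg, h.vel_nonneg] with x h1 h2 h3 h4
    rcases le_or_gt ‖x‖ R with hx | hx
    · have hi := abs_le.1 (inner_le_of_unit he x)
      -- On this range f is convex, so f' is larger at the reflected argument and the contribution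
      -- of w₀ has the favourable sign.
      have h5 := deriv_profile_mono (R := R) ha (z := 0 - inner ℝ x e)
        (z' := 2 * t + (-0 - inner ℝ x e)) (by linarith) (by linarith)
      have h6 := le_profile (R := R) (b := 2 * R + 2) ha (z := 0 - inner ℝ x e) (by linarith)
        (by linarith)
      have h7 := mul_le_mul_of_nonneg_left (hPge 0 x) h4
      have h8 := mul_le_mul_of_nonneg_left h6 h4
      have h9 := mul_nonneg h3 (sub_nonneg.2 h5)
      linear_combination h7 + (1 / 2) * h8 + (1 / 2) * h9
    · rw [h1 hx, h2 hx]; simp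
  rw [k1] at key
  constructor
  · have k3 := h.integral_le_source ht le_rfl ht0 le_rfl hPc (fun s _ x _ => hPpos s x) (k := 0)
      continuousOn_const (fun s _ x _ => hPpos s x)
    simp only [Pi.zero_apply, zero_mul, intervalIntegral.integral_zero] at k3
    have := mul_le_mul_of_nonneg_left k2 h.eps_pos.le
    linarith
  · intro ht1
    have hk2' : 0 ≤ (1 / 2) * (2 * R + 2) ^ (-a) * ∫ x, w₁ x := by
      have := integral_nonneg_of_ae h.vel_nonneg
      positivity
    have := mul_nonneg h.eps_pos.le (hk2'.trans k2)
    have k3 := h.integral_le_source ht zero_le_one ht1 le_rfl hPc (fun s _ x _ => hPpos s x)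
      (k := fun s => (1 / 2) * (2 * R + 5) ^ (-a) * s ^ (-a))
      (continuousOn_const.mul (ContinuousOn.rpow_const continuousOn_id
        fun s hs => Or.inl (zero_lt_one.trans_le hs.1).ne'))
      (fun s hs x hx => by
        have hi := abs_le.1 (inner_le_of_unit he x)
        have hs1 := hs.1
        refine le_trans ?_ (hPge s x)
        rw [mul_assoc, ← Real.mul_rpow (by linarith) (by linarith)]
        exact mul_le_mul_of_nonneg_left (le_profile ha (by linarith) (by nlinarith)) (by norm_num))
    have k4 : ∫ s in (1 : ℝ)..t, (1 / 2) * (2 * R + 5) ^ (-a) * s ^ (-a) * ∫ x, |g s x| ^ r =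
        (1 / 2) * (2 * R + 5) ^ (-a) * ∫ s in (1 : ℝ)..t, s ^ (-a) * ∫ x, |g s x| ^ r := by
      rw [← intervalIntegral.integral_const_mul]
      congr 1; ext s; ring
    linarith

/-- The moments of `w` against a plane wave dominate the contributions of the data and of
the source. -/
theorem position_moment_ge (h : IsSourcedWave T ε R w₀ w₁ w wt r g) {t a : ℝ}
    (ht : t ∈ timeInterval T) (ha : 0 ≤ a) {e : Space n} (he : ‖e‖ = 1) :
    ε * ((1 / 2) * (2 * R + 2) ^ (-a) * ∫ x, w₀ x) ≤
      ∫ x, w t x * profile a R (t - inner ℝ x e) ∧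
    (∀ δ : ℝ, 0 < δ → δ ≤ 1 → 1 + δ ≤ t →
      (1 / 2) * (2 * R + 6) ^ (-a) * δ * ∫ s in (1 : ℝ)..(t / (1 + δ)),
        s ^ (1 - a) * ∫ x, |g s x| ^ r ≤ ∫ x, w t x * profile a R (t - inner ℝ x e)) := by
  have hR := h.radius_pos
  have ht0 : 0 ≤ t := ht.1
  set F := profilePrimitive a R with hF
  have hFs : ContDiff ℝ ∞ F := profilePrimitive_contDiff a R
  -- Now the test wave ½ (F(2t - s - ⟨x, e⟩) - F(s - ⟨x, e⟩)), with F' = f, is odd about s = t: it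
  -- vanishes there and has time derivative -f(t - ⟨x, e⟩), so only w is left. It is nonnegative for
  -- s ≤ t because F increases.
  have d₁ : ContDiff ℝ ∞ (fun z => -(1 / 2) * F z) := contDiff_const.mul hFs
  have d₂ : ContDiff ℝ ∞ (fun z => 1 / 2 * F (2 * t + z)) :=
    contDiff_const.mul (hFs.comp (contDiff_const.add contDiff_id))
  have hFd : Differentiable ℝ F := hFs.differentiable (by simp)
  have e₁ : deriv (fun z => -(1 / 2) * F z) = fun z => -(1 / 2) * profile a R z := by
    ext z; rw [deriv_const_mul _ (hFd z), hF, deriv_profilePrimitive]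
  have e₂ : deriv (fun z => 1 / 2 * F (2 * t + z)) = fun z => 1 / 2 * profile a R (2 * t + z) := by
    ext z
    exact (((hasDerivAt_profilePrimitive a R (2 * t + z)).comp_const_add (2 * t) z).const_mul
      (1 / 2)).deriv
  have key := h.identity ht d₁ d₂ he
  set P := planeWave (fun z => -(1 / 2) * F z) (fun z => 1 / 2 * F (2 * t + z)) e with hP
  have hPeq : ∀ s x, P s x = 1 / 2 * (F (2 * t - s - inner ℝ x e) - F (s - inner ℝ x e)) := by
    intro s x; simp only [hP, planeWave]
    rw [show 2 * t + (-s - inner ℝ x e) = 2 * t - s - inner ℝ x e by ring]; ring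
  have hPpos : ∀ s ≤ t, ∀ x, 0 ≤ P s x := fun s hs x => by
    have := profilePrimitive_mono a R
      (show s - inner ℝ x e ≤ 2 * t - s - inner ℝ x e by linarith)
    rw [hPeq]; linarith
  have hPc : Continuous (Function.uncurry P) := (planeWave_contDiff d₁ d₂ e).continuous
  have hFc : Continuous F := hFs.continuous
  have hP0 : Continuous (P 0) := by rw [funext (hPeq 0)]; fun_prop
  rw [e₁, e₂] at key
  have k1 : ∫ x, (wt t x * P t x - w t x * (-(1 / 2) * profile a R (t - inner ℝ x e) -
      1 / 2 * profile a R (2 * t + (-t - inner ℝ x e)))) =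
      ∫ x, w t x * profile a R (t - inner ℝ x e) := by
    congr 1; ext x
    rw [hPeq, show 2 * t + (-t - inner ℝ x e) = t - inner ℝ x e by ring,
      show 2 * t - t - inner ℝ x e = t - inner ℝ x e by ring]
    ring
  have hfc : Continuous (profile a R) := (profile_contDiff a R).continuous
  have k2 : (1 / 2) * (2 * R + 2) ^ (-a) * ∫ x, w₀ x ≤
      ∫ x, (w₁ x * P 0 x - w₀ x * (-(1 / 2) * profile a R (0 - inner ℝ x e) -
        1 / 2 * profile a R (2 * t + (-0 - inner ℝ x e)))) := by
    rw [← integral_const_mul]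
    have hB : Continuous fun x : Space n => (-(1 / 2) * profile a R (0 - inner ℝ x e) -
        1 / 2 * profile a R (2 * t + (-0 - inner ℝ x e))) := by
      fun_prop
    have i1 := integrable_mul_of_supportedInBall h.supp_vel
      (φ := P 0) hP0
    have i2 := integrable_mul_of_supportedInBall h.supp_pos hB
    refine integral_mono_ae ((integrable_of_supportedInBall h.supp_pos).const_mul _)
      (i1.sub i2) ?_
    filter_upwards [h.supp_pos, h.supp_vel, h.pos_nonneg, h.vel_nonneg] with x h1 h2 h3 h4
    rcases le_or_gt ‖x‖ R with hx | hx
    · have hi := abs_le.1 (inner_le_of_unit he x)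
      have h6 := le_profile (R := R) (b := 2 * R + 2) ha (z := 0 - inner ℝ x e) (by linarith)
        (by linarith)
      have h7 := mul_nonneg h4 (hPpos 0 ht0 x)
      have h8 := mul_le_mul_of_nonneg_left h6 h3
      have h9 := mul_nonneg h3 (profile_pos a R (2 * t + (-0 - inner ℝ x e))).le
      linear_combination h7 + (1 / 2) * h8 + (1 / 2) * h9
    · rw [h1 hx, h2 hx]; simp
  rw [k1] at key
  constructor
  · have k3 := h.integral_le_source ht le_rfl ht0 le_rfl hPc (fun s hs x _ => hPpos s hs.2 x)
      (k := 0) continuousOn_const (fun s hs x _ => hPpos s hs.2 x)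
    simp only [Pi.zero_apply, zero_mul, intervalIntegral.integral_zero] at k3
    have := mul_le_mul_of_nonneg_left k2 h.eps_pos.le
    linarith
  · intro δ hδ0 hδ1 hδt
    have hk2' : 0 ≤ (1 / 2) * (2 * R + 2) ^ (-a) * ∫ x, w₀ x := by
      have := integral_nonneg_of_ae h.pos_nonneg
      positivity
    have := mul_nonneg h.eps_pos.le (hk2'.trans k2)
    have hβ : 1 ≤ t / (1 + δ) := by rwa [le_div_iff₀ (by linarith), one_mul]
    have hβt : t / (1 + δ) ≤ t := div_le_self ht0 (by linarith)
    have k3 := h.integral_le_source ht zero_le_one hβ hβt hPc (fun s hs x _ => hPpos s hs.2 x)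
      (k := fun s => (1 / 2) * (2 * R + 6) ^ (-a) * δ * s ^ (1 - a))
      (continuousOn_const.mul (ContinuousOn.rpow_const continuousOn_id
        fun s hs => Or.inl (zero_lt_one.trans_le hs.1).ne'))
      (fun s hs x hx => by
        have hi := abs_le.1 (inner_le_of_unit he x)
        have hs1 := hs.1
        have hs2 : s * (1 + δ) ≤ t := by rw [← le_div_iff₀ (by linarith)]; exact hs.2
        -- As (1 + δ)s ≤ t, the interval between the two arguments of F has length at least δs; on
        -- its first piece of that length f is at least ((2R + 6)s)^(-a). This gives the weight δ
        -- s^(1-a) and explains the delay.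
        have hδs : δ * s ≤ s := by nlinarith
        have hδs0 : 0 ≤ δ * s := by nlinarith
        have m1 := mul_le_profilePrimitive_sub (R := R) (l := δ * s) (b := (2 * R + 6) * s) ha
          (z := s - inner ℝ x e) hδs0 (by linarith) (by nlinarith)
        have m2 := profilePrimitive_mono a R
          (show s - inner ℝ x e + δ * s ≤ 2 * t - s - inner ℝ x e by linarith)
        rw [hPeq]
        have m3 : s ^ (1 - a) = s * s ^ (-a) := by
          rw [sub_eq_add_neg, Real.rpow_add (by linarith), Real.rpow_one]
        rw [Real.mul_rpow (by linarith) (by linarith)] at m1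
        rw [m3]
        linear_combination (1 / 2) * m1 + (1 / 2) * m2)
    have k4 : ∫ s in (1 : ℝ)..(t / (1 + δ)),
          (1 / 2) * (2 * R + 6) ^ (-a) * δ * s ^ (1 - a) * ∫ x, |g s x| ^ r =
        (1 / 2) * (2 * R + 6) ^ (-a) * δ *
          ∫ s in (1 : ℝ)..(t / (1 + δ)), s ^ (1 - a) * ∫ x, |g s x| ^ r := by
      rw [← intervalIntegral.integral_const_mul]
      congr 1; ext s; ring
    linarith

/-- A bound uniform over unit directions integrates over the ball; its centre, which has no
direction, is a null set. -/
theorem le_waveFunctional (hn : 1 ≤ n) {a s L : ℝ} (ha : 0 ≤ a) {f : Space n → ℝ}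
    (hf : Integrable f)
    (hL : ∀ e : Space n, ‖e‖ = 1 → L ≤ ∫ x, f x * profile a R (s - inner ℝ x e)) :
    volume.real (Metric.ball (0 : Space n) 1) * L ≤ waveFunctional a R s f := by
  have : Nonempty (Fin n) := ⟨⟨0, hn⟩⟩
  unfold waveFunctional
  rw [← smul_eq_mul, ← setIntegral_const]
  refine integral_mono_ae (integrable_const _) (integrable_waveFunctional ha R s hf) ?_
  refine ae_restrict_of_ae ?_
  filter_upwards [measure_eq_zero_iff_ae_notMem.1 (measure_singleton (0 : Space n))] with y hy
  exact hL _ (norm_direction hy)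

end IsSourcedWave

/-! ### Propagation of power lower bounds in time -/

/-- `D t^κ ≤ A t` for all `t ∈ [S, τ]`. -/
def PowerGe (A : ℝ → ℝ) (D κ S τ : ℝ) : Prop := ∀ t ∈ Icc S τ, D * t ^ κ ≤ A t

/-- `D s^κ ≤ P s` for almost all `s ∈ (S, τ]`. -/
def AePowerGe (P : ℝ → ℝ) (D κ S τ : ℝ) : Prop := ∀ᵐ s, s ∈ Ioc S τ → D * s ^ κ ≤ P s

/-- `A` dominates the time integrals of the source `Q` with weight `s^(-a)`. -/
structure VelocityDominates (c a τ : ℝ) (A Q : ℝ → ℝ) : Prop where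
  nonneg : ∀ s, 0 ≤ Q s
  integrable : IntervalIntegrable Q volume 0 τ
  le : ∀ t ∈ Icc 1 τ, c * ∫ s in (1 : ℝ)..t, s ^ (-a) * Q s ≤ A t

/-- `B` dominates the time integrals of the source `P` with weight `s^(1-b)`, up to a delay. -/
structure PositionDominates (c b τ : ℝ) (B P : ℝ → ℝ) : Prop where
  nonneg : ∀ s, 0 ≤ P s
  integrable : IntervalIntegrable P volume 0 τ
  le : ∀ δ : ℝ, 0 < δ → δ ≤ 1 → ∀ t ∈ Icc (1 + δ) τ,
    c * δ * ∫ s in (1 : ℝ)..(t / (1 + δ)), s ^ (1 - b) * P s ≤ B t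

/-- A Hölder type bound of `|A|^r` by `P`, with polynomial and logarithmic factors. -/
def HolderBound (C e k r τ : ℝ) (A P : ℝ → ℝ) : Prop :=
  ∀ᵐ s, s ∈ Ioc 1 τ → |A s| ^ r ≤ C * s ^ e * (1 + Real.log s) ^ k * P s

theorem mul_integral_rpow_le {Q : ℝ → ℝ} {k D κ S t τ : ℝ} (hQ : ∀ s, 0 ≤ Q s)
    (hi : IntervalIntegrable Q volume 0 τ) (hS : 1 ≤ S) (hSt : S ≤ t) (ht : t ≤ τ)
    (h : AePowerGe Q D κ S τ) :
    D * ∫ s in S..t, s ^ (k + κ) ≤ ∫ s in (1 : ℝ)..t, s ^ k * Q s := by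
  have hc : ∀ e : ℝ, ContinuousOn (fun s : ℝ => s ^ e) (Icc 1 t) := fun e =>
    ContinuousOn.rpow_const continuousOn_id fun s hs => Or.inl (zero_lt_one.trans_le hs.1).ne'
  have hi1 : IntervalIntegrable (fun s => s ^ k * Q s) volume 1 t := by
    refine (hi.mono_set ?_).continuousOn_mul (by rw [uIcc_of_le (hS.trans hSt)]; exact hc k)
    rw [uIcc_of_le (hS.trans hSt), uIcc_of_le (by linarith)]
    exact Icc_subset_Icc (by norm_num) ht
  have hsub : uIcc S t ⊆ uIcc 1 t := by
    rw [uIcc_of_le hSt, uIcc_of_le (hS.trans hSt)]; exact Icc_subset_Icc_left hS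
  have h1 : ∫ s in S..t, s ^ k * Q s ≤ ∫ s in (1 : ℝ)..t, s ^ k * Q s := by
    refine intervalIntegral.integral_mono_interval hS hSt le_rfl ?_ hi1
    refine (ae_restrict_iff' measurableSet_Ioc).2 (ae_of_all _ fun s hs => ?_)
    exact mul_nonneg (Real.rpow_nonneg (zero_le_one.trans hs.1.le) _) (hQ s)
  refine le_trans ?_ h1
  rw [← intervalIntegral.integral_const_mul]
  refine intervalIntegral.integral_mono_ae_restrict hSt ?_ (hi1.mono_set hsub) ?_
  · refine ContinuousOn.intervalIntegrable ?_
    exact continuousOn_const.mul ((hc _).mono (by rw [uIcc_of_le hSt]; exact Icc_subset_Icc_left hS))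
  · rw [← restrict_Ioc_eq_restrict_Icc, Filter.EventuallyLE, ae_restrict_iff' measurableSet_Ioc]
    filter_upwards [h] with s hs hs'
    have hs0 : 0 < s := by linarith [hs'.1]
    rw [Real.rpow_add hs0]
    have := mul_le_mul_of_nonneg_left (hs ⟨hs'.1, hs'.2.trans ht⟩) (Real.rpow_nonneg hs0.le k)
    linarith

theorem rpow_div_ge {t δ e : ℝ} (ht : 0 < t) (hδ : 0 ≤ δ) (hδ1 : δ ≤ 1) {s : ℝ}
    (h1 : t / (1 + δ) ≤ s) (h2 : s ≤ t) : 2 ^ (-|e|) * t ^ e ≤ s ^ e := by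
  have hs : t / 2 ≤ s := by
    refine le_trans ?_ h1
    exact div_le_div_of_nonneg_left ht.le (by linarith) (by linarith)
  have hs0 : 0 < s := by linarith
  rcases le_total 0 e with he | he
  · rw [abs_of_nonneg he]
    refine le_trans (le_of_eq ?_) (Real.rpow_le_rpow (by linarith) hs he)
    rw [Real.div_rpow ht.le (by norm_num), Real.rpow_neg (by norm_num), div_eq_inv_mul]
  · refine le_trans ?_ (Real.rpow_le_rpow_of_nonpos hs0 h2 he)
    have : (2 : ℝ) ^ (-|e|) ≤ 1 :=
      Real.rpow_le_one_of_one_le_of_nonpos (by norm_num) (by linarith [abs_nonneg e])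
    exact mul_le_of_le_one_left (Real.rpow_nonneg ht.le _) this

/-- Keeping only the last window [t/(1+δ), t] suffices: it has length at least δt/2, and there s is
comparable to t whatever the sign of e. -/
theorem integral_rpow_window_ge {S t δ : ℝ} (e : ℝ) (hS : 1 ≤ S) (hδ : 0 < δ) (hδ1 : δ ≤ 1)
    (ht : (1 + δ) * S ≤ t) :
    δ * (2 ^ (-|e|) / 2) * t ^ (e + 1) ≤ ∫ s in S..t, s ^ e := by
  have hδ' : 0 < 1 + δ := by linarith
  have ht0 : 0 < t := by nlinarith
  have hS' : S ≤ t / (1 + δ) := by rw [le_div_iff₀ hδ']; linarith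
  have hl : t / (1 + δ) ≤ t := div_le_self ht0.le (by linarith)
  have hc : ∀ α β : ℝ, 1 ≤ α → α ≤ β → IntervalIntegrable (fun s : ℝ => s ^ e) volume α β := by
    intro α β hα hαβ
    refine ContinuousOn.intervalIntegrable (ContinuousOn.rpow_const continuousOn_id fun s hs => ?_)
    rw [uIcc_of_le hαβ] at hs
    exact Or.inl (zero_lt_one.trans_le (hα.trans hs.1)).ne'
  have h1 : ∫ s in (t / (1 + δ))..t, s ^ e ≤ ∫ s in S..t, s ^ e := by
    refine intervalIntegral.integral_mono_interval hS' hl le_rfl ?_ (hc _ _ hS (hS'.trans hl))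
    refine (ae_restrict_iff' measurableSet_Ioc).2 (ae_of_all _ fun s hs => ?_)
    exact Real.rpow_nonneg (by linarith [hs.1]) _
  have h2 : ∫ _ in (t / (1 + δ))..t, 2 ^ (-|e|) * t ^ e ≤ ∫ s in (t / (1 + δ))..t, s ^ e :=
    intervalIntegral.integral_mono_on hl (by simp) (hc _ _ (hS.trans hS') hl)
      fun s hs => rpow_div_ge ht0 hδ.le hδ1 hs.1 hs.2
  refine le_trans ?_ (h2.trans h1)
  rw [intervalIntegral.integral_const, smul_eq_mul, Real.rpow_add ht0, Real.rpow_one]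
  have h3 : δ / 2 * t ≤ t - t / (1 + δ) := by
    rw [← sub_nonneg]
    have : t - t / (1 + δ) - δ / 2 * t = t * δ * (1 - δ) / (2 * (1 + δ)) := by field_simp; ring
    rw [this]
    have : 0 ≤ 1 - δ := by linarith
    positivity
  have h4 := mul_le_mul_of_nonneg_right h3
    (by positivity : (0 : ℝ) ≤ 2 ^ (-|e|) * t ^ e)
  linear_combination h4

theorem integral_rpow_neg_one {S t : ℝ} (hS : 0 < S) (ht : 0 < t) :
    ∫ s in S..t, s ^ (-1 : ℝ) = Real.log (t / S) := by
  simp_rw [Real.rpow_neg_one]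
  exact integral_inv_of_pos hS ht

/-- Moving from S to S exp(Λη) leaves room for two factors 1 + η/2: one for the delay in
`PositionDominates`, one for the integration window. -/
theorem one_add_sq_le_exp {η Λ : ℝ} (hη : 0 < η) (hΛ : 1 ≤ Λ) :
    (1 + η / 2) ^ 2 ≤ Real.exp (Λ * η) := by
  have h1 : 1 + η / 2 ≤ Real.exp (η / 2) := by linarith [Real.add_one_le_exp (η / 2)]
  calc (1 + η / 2) ^ 2 ≤ Real.exp (η / 2) ^ 2 := pow_le_pow_left₀ (by linarith) h1 2
    _ = Real.exp η := by rw [← Real.exp_nat_mul]; congr 1; push_cast; ring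
    _ ≤ _ := Real.exp_le_exp.2 (by nlinarith)

theorem VelocityDominates.power_step {c : ℝ} (hc : 0 < c) (κ : ℝ) :
    ∃ c' : ℝ, 0 < c' ∧ ∀ (A Q : ℝ → ℝ) (D S τ η Λ : ℝ), VelocityDominates c 0 τ A Q →
      0 ≤ D → 1 ≤ S → 0 < η → η ≤ 1 → 1 ≤ Λ → AePowerGe Q D κ S τ →
      PowerGe A (c' * η * D) (κ + 1) (S * Real.exp (Λ * η)) τ := by
  refine ⟨c * (2 ^ (-|κ|) / 4), by positivity, fun A Q D S τ η Λ h hD hS hη hη1 hΛ hQ t ht => ?_⟩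
  have h1 := one_add_sq_le_exp hη hΛ
  have h2 : (1 + η / 2) * S ≤ t := by
    refine le_trans ?_ ht.1
    rw [mul_comm]
    exact mul_le_mul_of_nonneg_left (by nlinarith) (by linarith)
  have hSt : S ≤ t := by nlinarith
  have h3 := mul_integral_rpow_le (k := -0) h.nonneg h.integrable hS hSt ht.2 hQ
  have h4 := integral_rpow_window_ge κ hS (half_pos hη) (by linarith) h2
  have h5 := h.le t ⟨hS.trans hSt, ht.2⟩
  rw [neg_zero, zero_add] at h3
  rw [neg_zero] at h5
  have h6 := mul_le_mul_of_nonneg_left ((mul_le_mul_of_nonneg_left h4 hD).trans h3) hc.le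
  linear_combination h6 + h5

/-- The relation κ = a - 1 turns the integrand into 1/s, and log(t/S) ≥ Λη: the power of time is
lost, but a factor Λ is gained. -/
theorem VelocityDominates.log_step {c a κ : ℝ} (hc : 0 < c) (hκ : κ = a - 1)
    {A Q : ℝ → ℝ} {D S τ η Λ : ℝ} (h : VelocityDominates c a τ A Q)
    (hD : 0 ≤ D) (hS : 1 ≤ S) (hη : 0 < η) (hΛ : 1 ≤ Λ) (hQ : AePowerGe Q D κ S τ) :
    PowerGe A (c * η * Λ * D) 0 (S * Real.exp (Λ * η)) τ := by
  intro t ht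
  have hS0 : 0 < S := by linarith
  have h1 : 1 ≤ Real.exp (Λ * η) := Real.one_le_exp (by positivity)
  have hSt : S ≤ t := le_trans (by nlinarith) ht.1
  have h3 := mul_integral_rpow_le (k := -a) h.nonneg h.integrable hS hSt ht.2 hQ
  rw [show -a + κ = -1 by rw [hκ]; ring, integral_rpow_neg_one hS0 (by linarith)] at h3
  have h4 : Λ * η ≤ Real.log (t / S) := by
    rw [Real.le_log_iff_exp_le (by apply div_pos <;> linarith), le_div_iff₀ hS0]
    linarith [ht.1]
  have h5 := h.le t ⟨hS.trans hSt, ht.2⟩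
  rw [Real.rpow_zero]
  have h6 := mul_le_mul_of_nonneg_left ((mul_le_mul_of_nonneg_left h4 hD).trans h3) hc.le
  linear_combination h6 + h5

theorem PositionDominates.power_step {c : ℝ} (hc : 0 < c) (κ : ℝ) :
    ∃ c' : ℝ, 0 < c' ∧ ∀ (B P : ℝ → ℝ) (D S τ η Λ : ℝ), PositionDominates c 0 τ B P →
      0 ≤ D → 1 ≤ S → 0 < η → η ≤ 1 → 1 ≤ Λ → AePowerGe P D κ S τ →
      PowerGe B (c' * η ^ 2 * D) (κ + 2) (S * Real.exp (Λ * η)) τ := by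
  refine ⟨c * (2 ^ (-|1 + κ|) / 8) * 2 ^ (-|κ + 2|), by positivity,
    fun B P D S τ η Λ h hD hS hη hη1 hΛ hP t ht => ?_⟩
  have h1 := one_add_sq_le_exp hη hΛ
  have hδ : 0 < 1 + η / 2 := by linarith
  have h2 : (1 + η / 2) ^ 2 * S ≤ t := by
    refine le_trans ?_ ht.1
    rw [mul_comm]
    exact mul_le_mul_of_nonneg_left h1 (by linarith)
  have h2' : (1 + η / 2) * S ≤ t / (1 + η / 2) := by
    rw [le_div_iff₀ hδ]; linarith
  have ht0 : 0 < t := by nlinarith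
  have hSt : S ≤ t / (1 + η / 2) := by nlinarith
  have htt : t / (1 + η / 2) ≤ t := div_le_self ht0.le (by linarith)
  have h3 := mul_integral_rpow_le (k := 1 - 0) h.nonneg h.integrable hS hSt (htt.trans ht.2) hP
  have h4 := integral_rpow_window_ge (1 + κ) hS (half_pos hη) (by linarith) h2'
  have h5 := h.le (η / 2) (half_pos hη) (by linarith) t ⟨by nlinarith, ht.2⟩
  have h6 := rpow_div_ge (e := κ + 2) ht0 (half_pos hη).le (by linarith) le_rfl htt
  rw [show 1 + κ + 1 = κ + 2 by ring] at h4
  rw [sub_zero] at h3 h5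
  have h7 := mul_le_mul_of_nonneg_left h6
    (by positivity : 0 ≤ η / 2 * (2 ^ (-|1 + κ|) / 2))
  have h8 := mul_le_mul_of_nonneg_left ((mul_le_mul_of_nonneg_left (h7.trans h4) hD).trans h3)
    (by positivity : 0 ≤ c * (η / 2))
  linear_combination h8 + h5

theorem PositionDominates.log_step {c b κ : ℝ} (hc : 0 < c) (hκ : κ = b - 2)
    {B P : ℝ → ℝ} {D S τ η Λ : ℝ} (h : PositionDominates c b τ B P)
    (hD : 0 ≤ D) (hS : 1 ≤ S) (hη : 0 < η) (hη1 : η ≤ 1) (hΛ : 1 ≤ Λ)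
    (hP : AePowerGe P D κ S τ) :
    PowerGe B (c / 4 * η ^ 2 * Λ * D) 0 (S * Real.exp (Λ * η)) τ := by
  intro t ht
  have hS0 : 0 < S := by linarith
  have h1 := one_add_sq_le_exp hη hΛ
  have hδ : 0 < 1 + η / 2 := by linarith
  have h2 : (1 + η / 2) ^ 2 * S ≤ t := by
    refine le_trans ?_ ht.1
    rw [mul_comm]
    exact mul_le_mul_of_nonneg_left h1 (by linarith)
  have h2' : (1 + η / 2) * S ≤ t / (1 + η / 2) := by
    rw [le_div_iff₀ hδ]; linarith
  have ht0 : 0 < t := by nlinarith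
  have hSt : S ≤ t / (1 + η / 2) := by nlinarith
  have htt : t / (1 + η / 2) ≤ t := div_le_self ht0.le (by linarith)
  have h3 := mul_integral_rpow_le (k := 1 - b) h.nonneg h.integrable hS hSt (htt.trans ht.2) hP
  -- Again the integrand is 1/s. The delay costs log(1 + η/2) ≤ η/2, which is at most half of Λη
  -- because Λ ≥ 1.
  rw [show 1 - b + κ = -1 by rw [hκ]; ring, integral_rpow_neg_one hS0 (by positivity)] at h3
  have h4 : Λ * η / 2 ≤ Real.log (t / (1 + η / 2) / S) := by
    rw [div_right_comm, Real.log_div (by positivity) hδ.ne']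
    have h5 : Λ * η ≤ Real.log (t / S) := by
      rw [Real.le_log_iff_exp_le (by positivity), le_div_iff₀ hS0]
      linarith [ht.1]
    have h6 : Real.log (1 + η / 2) ≤ η / 2 := by
      have := Real.log_le_sub_one_of_pos hδ; linarith
    nlinarith
  have h5 := h.le (η / 2) (half_pos hη) (by linarith) t ⟨by nlinarith, ht.2⟩
  rw [Real.rpow_zero]
  have h8 := mul_le_mul_of_nonneg_left ((mul_le_mul_of_nonneg_left h4 hD).trans h3)
    (by positivity : 0 ≤ c * (η / 2))
  linear_combination h8 + h5

/-- Up to time exp(2Λ) one has 1 + log s ≤ 3Λ, so the logarithm in the Hölder bound becomes the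
constant loss Λ^(-k). -/
theorem HolderBound.power_step {C e k r τ Λ κ X S : ℝ} {A P : ℝ → ℝ} (h : HolderBound C e k r τ A P)
    (hC : 0 < C) (hk : 0 ≤ k) (hr : 0 < r) (hΛ : 1 ≤ Λ) (hτ : τ ≤ Real.exp (2 * Λ)) (hS : 1 ≤ S)
    (hX : 0 ≤ X) (hA : PowerGe A X κ S τ) :
    AePowerGe P ((C * 3 ^ k)⁻¹ * X ^ r * Λ ^ (-k)) (κ * r - e) S τ := by
  filter_upwards [h] with s hs hs'
  have hs1 : 1 < s := hS.trans_lt hs'.1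
  have hs0 : 0 < s := by linarith
  have h1 := hs ⟨hs1, hs'.2⟩
  have hlog : 0 ≤ Real.log s := Real.log_nonneg hs1.le
  have hlog2 : Real.log s ≤ 2 * Λ := by
    rw [Real.log_le_iff_le_exp hs0]; exact hs'.2.trans hτ
  have h2 := hA s ⟨hs'.1.le, hs'.2⟩
  have h3 : X ^ r * s ^ (κ * r) ≤ |A s| ^ r := by
    have h4 : X * s ^ κ ≤ |A s| := h2.trans (le_abs_self _)
    have := Real.rpow_le_rpow (by positivity) h4 hr.le
    rwa [Real.mul_rpow hX (by positivity), ← Real.rpow_mul hs0.le] at this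
  -- Nonnegativity is forced by the Hölder bound itself, whose left side is nonnegative and whose
  -- prefactor is positive.
  have hP : 0 ≤ P s := by
    by_contra hneg
    have : C * s ^ e * (1 + Real.log s) ^ k * P s < 0 :=
      mul_neg_of_pos_of_neg (by positivity) (not_le.1 hneg)
    linarith [Real.rpow_nonneg (abs_nonneg (A s)) r]
  have h5 : (1 + Real.log s) ^ k ≤ 3 ^ k * Λ ^ k := by
    rw [← Real.mul_rpow (by norm_num) (by linarith)]
    exact Real.rpow_le_rpow (by linarith) (by linarith) hk
  have h6 : X ^ r * s ^ (κ * r) ≤ C * s ^ e * (3 ^ k * Λ ^ k) * P s :=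
    (h3.trans h1).trans (by gcongr)
  have hΛk : 0 < Λ ^ k := by positivity
  rw [Real.rpow_sub hs0, Real.rpow_neg (by linarith)]
  have he : 0 < s ^ e := by positivity
  have h3k : (0 : ℝ) < 3 ^ k := by positivity
  have h7 : (C * 3 ^ k)⁻¹ * X ^ r * (Λ ^ k)⁻¹ * (s ^ (κ * r) / s ^ e) =
      (X ^ r * s ^ (κ * r)) / (C * s ^ e * (3 ^ k * Λ ^ k)) := by
    field_simp
  rw [h7, div_le_iff₀ (by positivity)]
  linarith

theorem PowerGe.mono {A : ℝ → ℝ} {D D' κ S S' τ : ℝ} (h : PowerGe A D κ S τ) (hS : S ≤ S')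
    (hS0 : 0 ≤ S') (hD : D' ≤ D) : PowerGe A D' κ S' τ := fun t ht =>
  (mul_le_mul_of_nonneg_right hD (Real.rpow_nonneg (hS0.trans ht.1) _)).trans
    (h t ⟨hS.trans ht.1, ht.2⟩)

/-! ### Iteration and the feedback loops -/

/-- A lower bound which improves superlinearly on a sequence of shrinking windows of fixed total
length is impossible if it is large at the start. -/
theorem no_superlinear_growth {F : ℝ → ℝ} {Λ X₀ c k r : ℝ} (hr : 1 < r) (hk : 0 ≤ k) (hc : 0 < c)
    (hX₀ : 0 < X₀) (h0 : PowerGe F X₀ 0 (Real.exp Λ) (Real.exp (2 * Λ))) (hΛ : 1 ≤ Λ)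
    (hstep : ∀ η S X : ℝ, 0 < η → η ≤ 1 → 1 ≤ S → 0 < X → PowerGe F X 0 S (Real.exp (2 * Λ)) →
      PowerGe F (c * η ^ k * X ^ r) 0 (S * Real.exp (Λ * η)) (Real.exp (2 * Λ)))
    (hbig : 2 * 2 ^ k * 2 ^ (k / (r - 1)) ≤ c * X₀ ^ (r - 1)) : False := by
  have hr1 : 0 < r - 1 := by linarith
  -- Besides growth by 2^j, the induction carries a lower bound on c X^(r-1) that grows like
  -- (2^k)^j; it compensates the loss η^k for η = 2^(-(j+1)). Multiplying X by 2 · 2^(k/(r-1)) at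
  -- each step preserves both.
  have key : ∀ j : ℕ, ∃ X : ℝ, 2 ^ j * X₀ ≤ X ∧
      (2 * 2 ^ k * 2 ^ (k / (r - 1))) * (2 ^ k) ^ j ≤ c * X ^ (r - 1) ∧
      PowerGe F X 0 (Real.exp (Λ * (2 - (1 / 2) ^ j))) (Real.exp (2 * Λ)) := by
    intro j
    induction j with
    | zero =>
      refine ⟨X₀, by simp, by simpa using hbig, ?_⟩
      have : Λ * (2 - (1 / 2) ^ 0) = Λ := by norm_num
      rwa [this]
    | succ j ih =>
      obtain ⟨X, h1, h2, h3⟩ := ih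
      have hX : 0 < X := lt_of_lt_of_le (by positivity) h1
      have hpow1 : ((1 : ℝ) / 2) ^ j ≤ 1 := pow_le_one₀ (by norm_num) (by norm_num)
      have h4 := hstep ((1 / 2) ^ (j + 1)) _ X (by positivity)
        (pow_le_one₀ (by norm_num) (by norm_num)) (Real.one_le_exp (by nlinarith)) hX h3
      have hη : (((1 : ℝ) / 2) ^ (j + 1)) ^ k * (2 ^ k) ^ j = (2 ^ k)⁻¹ := by
        have e1 : (((1 : ℝ) / 2) ^ (j + 1)) ^ k = ((2 ^ k)⁻¹) ^ (j + 1) := by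
          rw [← Real.rpow_natCast, ← Real.rpow_mul (by norm_num), mul_comm,
            Real.rpow_mul (by norm_num), Real.rpow_natCast, one_div,
            Real.inv_rpow (by norm_num)]
        have : (2 : ℝ) ^ k ≠ 0 := by positivity
        rw [e1, pow_succ, inv_pow]
        field_simp
      have h5 : (2 * 2 ^ (k / (r - 1))) * X ≤ c * ((1 / 2) ^ (j + 1)) ^ k * X ^ r := by
        have e2 : X ^ r = X * X ^ (r - 1) := by
          rw [Real.rpow_sub hX, Real.rpow_one]; field_simp
        have e3 : 2 * 2 ^ (k / (r - 1)) = (((1 : ℝ) / 2) ^ (j + 1)) ^ k *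
            ((2 * 2 ^ k * 2 ^ (k / (r - 1))) * (2 ^ k) ^ j) := by
          have h2k : (2 : ℝ) ^ k ≠ 0 := by positivity
          have e5 : (2 : ℝ) * 2 ^ (k / (r - 1)) =
              (2 * 2 ^ k * 2 ^ (k / (r - 1))) * (2 ^ k)⁻¹ := by field_simp
          rw [e5, ← hη]; ring
        rw [e2, e3]
        have := mul_le_mul_of_nonneg_left h2
          (by positivity : 0 ≤ (((1 : ℝ) / 2) ^ (j + 1)) ^ k * X)
        linear_combination this
      have hone : (1 : ℝ) ≤ 2 ^ (k / (r - 1)) := Real.one_le_rpow (by norm_num) (by positivity)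
      refine ⟨(2 * 2 ^ (k / (r - 1))) * X, ?_, ?_, ?_⟩
      · rw [pow_succ]
        have : 2 * X ≤ (2 * 2 ^ (k / (r - 1))) * X := by nlinarith
        linarith
      · have e4 : ((2 * 2 ^ (k / (r - 1))) * X) ^ (r - 1) = 2 ^ (r - 1) * 2 ^ k * X ^ (r - 1) := by
          rw [Real.mul_rpow (by positivity) hX.le, Real.mul_rpow (by norm_num) (by positivity),
            ← Real.rpow_mul (by norm_num), div_mul_cancel₀ _ hr1.ne']
        have h2r : (1 : ℝ) ≤ 2 ^ (r - 1) := Real.one_le_rpow (by norm_num) hr1.le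
        rw [e4, pow_succ]
        have h6 := mul_le_mul_of_nonneg_left h2 (by positivity : (0 : ℝ) ≤ 2 ^ k)
        have h7 : 2 ^ k * (c * X ^ (r - 1)) ≤ 2 ^ (r - 1) * (2 ^ k * (c * X ^ (r - 1))) :=
          le_mul_of_one_le_left (by positivity) h2r
        linear_combination h6 + h7
      · refine h4.mono (le_of_eq ?_) (Real.exp_nonneg _) h5
        rw [← Real.exp_add]
        congr 1; rw [pow_succ]; ring
  -- All windows contain the endpoint exp(2Λ), so the single number F(exp(2Λ)) would exceed every
  -- 2^j X₀.
  have hF : ∀ j : ℕ, 2 ^ j * X₀ ≤ F (Real.exp (2 * Λ)) := by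
    intro j
    obtain ⟨X, h1, -, h3⟩ := key j
    have := h3 (Real.exp (2 * Λ)) ⟨Real.exp_le_exp.2 (by
      have : (0 : ℝ) ≤ (1 / 2) ^ j := by positivity
      nlinarith), le_rfl⟩
    rw [Real.rpow_zero, mul_one] at this
    exact h1.trans this
  obtain ⟨j, hj⟩ := pow_unbounded_of_one_lt (F (Real.exp (2 * Λ)) / X₀) (one_lt_two (α := ℝ))
  rw [div_lt_iff₀ hX₀] at hj
  exact absurd (hF j) (not_le.2 hj)

/-- Half of the window is spent on a power step for B and half on a logarithmic step for A. The
power step loses η², which becomes η^(2q) under the exponent q of the Hölder bound; the logarithmic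
step contributes ηΛ. -/
theorem velocity_position_chain {cA cB C a κ e q : ℝ} (hcA : 0 < cA) (hcB : 0 < cB) (hC : 0 < C)
    (hq : 1 < q) (hexp : (κ + 2) * q - e = a - 1) :
    ∃ c : ℝ, 0 < c ∧ ∀ (A B P Q : ℝ → ℝ) (D S η Λ : ℝ),
      VelocityDominates cA a (Real.exp (2 * Λ)) A Q → PositionDominates cB 0 (Real.exp (2 * Λ)) B P →
      HolderBound C e 0 q (Real.exp (2 * Λ)) B Q → 0 ≤ D → 1 ≤ S → 0 < η → η ≤ 1 → 1 ≤ Λ →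
      AePowerGe P D κ S (Real.exp (2 * Λ)) →
      PowerGe A (c * η ^ (2 * q + 1) * Λ ^ (1 : ℝ) * D ^ q) 0 (S * Real.exp (Λ * η))
        (Real.exp (2 * Λ)) := by
  obtain ⟨c', hc', hB⟩ := PositionDominates.power_step hcB κ
  refine ⟨cA * (1 / 2) * (C⁻¹ * (c' * (1 / 4)) ^ q), by positivity,
    fun A B P Q D S η Λ hA hBP hH hD hS hη hη1 hΛ hP => ?_⟩
  have hexp1 : 1 ≤ Real.exp (Λ * (η / 2)) := Real.one_le_exp (by positivity)
  have hS' : 1 ≤ S * Real.exp (Λ * (η / 2)) := one_le_mul_of_one_le_of_one_le hS hexp1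
  have h1 := hB B P D S _ (η / 2) Λ hBP hD hS (half_pos hη) (by linarith) hΛ hP
  have h2 := hH.power_step hC le_rfl (by linarith) hΛ le_rfl hS' (by positivity) h1
  have h3 := hA.log_step hcA hexp (by positivity) hS' (half_pos hη) hΛ h2
  refine h3.mono (le_of_eq ?_) (by positivity) (le_of_eq ?_)
  · rw [mul_assoc, ← Real.exp_add]; congr 2; ring
  · rw [neg_zero, Real.rpow_zero, Real.rpow_zero, Real.rpow_one, Real.rpow_add hη, Real.rpow_one,
      Real.rpow_mul hη.le, Real.rpow_two,
      show c' * (η / 2) ^ 2 * D = (c' * (1 / 4)) * η ^ 2 * D by ring,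
      Real.mul_rpow (by positivity) hD, Real.mul_rpow (x := c' * (1 / 4)) (by positivity) (by positivity)]
    ring

/-- The mirror image: the power step for A loses η, raised to the power p, and the logarithmic step
for B contributes η²Λ. -/
theorem position_velocity_chain {cA cB C b κ e p : ℝ} (hcA : 0 < cA) (hcB : 0 < cB) (hC : 0 < C)
    (hp : 1 < p) (hexp : (κ + 1) * p - e = b - 2) :
    ∃ c : ℝ, 0 < c ∧ ∀ (A B P Q : ℝ → ℝ) (D S η Λ : ℝ),
      VelocityDominates cA 0 (Real.exp (2 * Λ)) A Q → PositionDominates cB b (Real.exp (2 * Λ)) B P →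
      HolderBound C e 0 p (Real.exp (2 * Λ)) A P → 0 ≤ D → 1 ≤ S → 0 < η → η ≤ 1 → 1 ≤ Λ →
      AePowerGe Q D κ S (Real.exp (2 * Λ)) →
      PowerGe B (c * η ^ (p + 2) * Λ ^ (1 : ℝ) * D ^ p) 0 (S * Real.exp (Λ * η))
        (Real.exp (2 * Λ)) := by
  obtain ⟨c', hc', hA⟩ := VelocityDominates.power_step hcA κ
  refine ⟨cB / 16 * (C⁻¹ * (c' * (1 / 2)) ^ p), by positivity,
    fun A B P Q D S η Λ hAQ hB hH hD hS hη hη1 hΛ hQ => ?_⟩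
  have hexp1 : 1 ≤ Real.exp (Λ * (η / 2)) := Real.one_le_exp (by positivity)
  have hS' : 1 ≤ S * Real.exp (Λ * (η / 2)) := one_le_mul_of_one_le_of_one_le hS hexp1
  have h1 := hA A Q D S _ (η / 2) Λ hAQ hD hS (half_pos hη) (by linarith) hΛ hQ
  have h2 := hH.power_step hC le_rfl (by linarith) hΛ le_rfl hS' (by positivity) h1
  have h3 := hB.log_step hcB hexp (by positivity) hS' (half_pos hη) (by linarith) hΛ h2
  refine h3.mono (le_of_eq ?_) (by positivity) (le_of_eq ?_)
  · rw [mul_assoc, ← Real.exp_add]; congr 2; ring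
  · rw [neg_zero, Real.rpow_zero, Real.rpow_zero, Real.rpow_one, Real.rpow_add hη, Real.rpow_two,
      show c' * (η / 2) * D = (c' * (1 / 2)) * η * D by ring,
      Real.mul_rpow (by positivity) hD, Real.mul_rpow (x := c' * (1 / 2)) (by positivity) hη.le]
    ring

/-- Both steps are logarithmic. The first yields Λ^q after the exponent q, of which the logarithmic
Hölder loss removes Λ^(q-1); the second adds another Λ. Hence Λ². -/
theorem log_log_chain {cA cB C a b κ e q : ℝ} (hcA : 0 < cA) (hcB : 0 < cB) (hC : 0 < C)
    (hq : 1 < q) (hκ : κ = b - 2) (he : -e = a - 1) :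
    ∃ c : ℝ, 0 < c ∧ ∀ (A B P Q : ℝ → ℝ) (D S η Λ : ℝ),
      VelocityDominates cA a (Real.exp (2 * Λ)) A Q → PositionDominates cB b (Real.exp (2 * Λ)) B P →
      HolderBound C e (q - 1) q (Real.exp (2 * Λ)) B Q → 0 ≤ D → 1 ≤ S → 0 < η → η ≤ 1 → 1 ≤ Λ →
      AePowerGe P D κ S (Real.exp (2 * Λ)) →
      PowerGe A (c * η ^ (2 * q + 1) * Λ ^ (2 : ℝ) * D ^ q) 0 (S * Real.exp (Λ * η))
        (Real.exp (2 * Λ)) := by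
  refine ⟨cA * (1 / 2) * ((C * 3 ^ (q - 1))⁻¹ * (cB / 16) ^ q), by positivity,
    fun A B P Q D S η Λ hA hB hH hD hS hη hη1 hΛ hP => ?_⟩
  have hΛ0 : 0 < Λ := by linarith
  have hexp1 : 1 ≤ Real.exp (Λ * (η / 2)) := Real.one_le_exp (by positivity)
  have hS' : 1 ≤ S * Real.exp (Λ * (η / 2)) := one_le_mul_of_one_le_of_one_le hS hexp1
  have h1 := hB.log_step hcB hκ hD hS (half_pos hη) (by linarith) hΛ hP
  have h2 := hH.power_step hC (by linarith) (by linarith) hΛ le_rfl hS' (by positivity) h1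
  have h3 := hA.log_step hcA (by linarith) (by positivity) hS' (half_pos hη) hΛ h2
  refine h3.mono (le_of_eq ?_) (by positivity) (le_of_eq ?_)
  · rw [mul_assoc, ← Real.exp_add]; congr 2; ring
  · rw [Real.rpow_add hη, Real.rpow_one, Real.rpow_mul hη.le, Real.rpow_two, Real.rpow_two,
      show cB / 4 * (η / 2) ^ 2 * Λ * D = (cB / 16) * η ^ 2 * Λ * D by ring,
      Real.mul_rpow (by positivity) hD, Real.mul_rpow (by positivity) hΛ0.le,
      Real.mul_rpow (x := cB / 16) (by positivity) (by positivity)]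
    have : Λ ^ q * Λ ^ (-(q - 1)) = Λ := by
      rw [← Real.rpow_add hΛ0]; ring_nf; exact Real.rpow_one Λ
    linear_combination (cA * (1 / 2) * ((C * 3 ^ (q - 1))⁻¹ * (cB / 16) ^ q) * η * (η ^ 2) ^ q *
      Λ * D ^ q) * (-this)

theorem lifespan_of_superlinear_growth {c c₀ θ k r σ ν : ℝ} (hr : 1 < r) (hc : 0 < c)
    (hc₀ : 0 < c₀) (hk : 0 ≤ k) (hν : 0 ≤ ν) (hpos : 0 < θ + (r - 1))
    (hexp : ν * (θ + (r - 1)) = σ * (r - 1)) :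
    ∃ C : ℝ, 0 < C ∧ ∀ (ε : ℝ) (T : EReal) (F : ℝ → ℝ), 0 < ε → ε ≤ 1 →
      (∀ Λ : ℝ, 1 ≤ Λ → ((Real.exp (2 * Λ) : ℝ) : EReal) < T →
        PowerGe F (c₀ * ε ^ σ * Λ) 0 (Real.exp Λ) (Real.exp (2 * Λ)) ∧
        ∀ η S X : ℝ, 0 < η → η ≤ 1 → 1 ≤ S → 0 < X → PowerGe F X 0 S (Real.exp (2 * Λ)) →
          PowerGe F (c * Λ ^ θ * η ^ k * X ^ r) 0 (S * Real.exp (Λ * η)) (Real.exp (2 * Λ))) →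
      T ≤ (Real.exp (C * ε ^ (-ν)) : ℝ) := by
  set E : ℝ := 2 * 2 ^ k * 2 ^ (k / (r - 1)) with hE
  have hE0 : 0 < E := by positivity
  -- Chosen so that c c₀^(r-1) C₁^(θ + r - 1) is at least the threshold E of
  -- `no_superlinear_growth`. With Λ = C₁ ε^(-ν), the relation `hexp` cancels every power of ε; the
  -- maximum with 1 keeps Λ ≥ 1.
  set C₁ := max 1 ((E / (c * c₀ ^ (r - 1))) ^ (θ + (r - 1))⁻¹) with hC₁
  have hC₁1 : 1 ≤ C₁ := le_max_left _ _
  have hC₁0 : 0 < C₁ := by linarith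
  refine ⟨2 * C₁, by linarith, fun ε T F hε hε1 h => ?_⟩
  by_contra hT
  rw [not_le] at hT
  set Λ := C₁ * ε ^ (-ν) with hΛ
  have hεν : 1 ≤ ε ^ (-ν) := Real.one_le_rpow_of_pos_of_le_one_of_nonpos hε hε1 (by linarith)
  have hΛ1 : 1 ≤ Λ := one_le_mul_of_one_le_of_one_le hC₁1 hεν
  have hΛ0 : 0 < Λ := by linarith
  rw [mul_assoc, ← hΛ] at hT
  obtain ⟨h1, h2⟩ := h Λ hΛ1 hT
  refine no_superlinear_growth hr hk (c := c * Λ ^ θ) (by positivity) (X₀ := c₀ * ε ^ σ * Λ)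
    (by positivity) h1 hΛ1 h2 ?_
  have e1 : c * Λ ^ θ * (c₀ * ε ^ σ * Λ) ^ (r - 1) =
      c * c₀ ^ (r - 1) * (ε ^ (σ * (r - 1)) * Λ ^ (θ + (r - 1))) := by
    rw [Real.mul_rpow (by positivity) hΛ0.le, Real.mul_rpow hc₀.le (by positivity),
      ← Real.rpow_mul hε.le, Real.rpow_add hΛ0]
    ring
  have e2 : ε ^ (σ * (r - 1)) * Λ ^ (θ + (r - 1)) = C₁ ^ (θ + (r - 1)) := by
    rw [hΛ, Real.mul_rpow hC₁0.le (by positivity), ← Real.rpow_mul hε.le, neg_mul, hexp,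
      Real.rpow_neg hε.le]
    have : ε ^ (σ * (r - 1)) ≠ 0 := by positivity
    field_simp
  have e3 : E / (c * c₀ ^ (r - 1)) ≤ C₁ ^ (θ + (r - 1)) := by
    calc _ = ((E / (c * c₀ ^ (r - 1))) ^ (θ + (r - 1))⁻¹) ^ (θ + (r - 1)) := by
          rw [← Real.rpow_mul (by positivity), inv_mul_cancel₀ hpos.ne', Real.rpow_one]
      _ ≤ _ := Real.rpow_le_rpow (by positivity) (le_max_right _ _) hpos.le
  rw [div_le_iff₀ (by positivity)] at e3
  rw [e1, e2]
  linarith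

/-- The growth step obtained by feeding a logarithmic Hölder bound into a chain of estimates. -/
theorem growth_step_of_chain {F P : ℝ → ℝ} {c C e k θ r s κ Λ : ℝ} (hC : 0 < C)
    (hr : 1 < r) (hΛ : 1 ≤ Λ) (hκ : κ = -e)
    (hH : HolderBound C e (r - 1) r (Real.exp (2 * Λ)) F P)
    (hchain : ∀ η S D : ℝ, 0 ≤ D → 1 ≤ S → 0 < η → η ≤ 1 →
      AePowerGe P D κ S (Real.exp (2 * Λ)) →
      PowerGe F (c * η ^ k * Λ ^ θ * D ^ s) 0 (S * Real.exp (Λ * η)) (Real.exp (2 * Λ)))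
    {η S X : ℝ} (hη : 0 < η) (hη1 : η ≤ 1) (hS : 1 ≤ S) (hX : 0 < X)
    (hF : PowerGe F X 0 S (Real.exp (2 * Λ))) :
    PowerGe F (c * ((C * 3 ^ (r - 1))⁻¹) ^ s * Λ ^ (θ - s * (r - 1)) * η ^ k * X ^ (r * s)) 0
      (S * Real.exp (Λ * η)) (Real.exp (2 * Λ)) := by
  have hΛ0 : 0 < Λ := by linarith
  have h1 := hH.power_step hC (by linarith) (by linarith) hΛ le_rfl hS hX.le hF
  rw [zero_mul, zero_sub, ← hκ] at h1
  have h2 := hchain η S _ (by positivity) hS hη hη1 h1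
  refine h2.mono le_rfl (by positivity) (le_of_eq ?_)
  rw [Real.mul_rpow (by positivity) (by positivity), Real.mul_rpow (by positivity) (by positivity),
    ← Real.rpow_mul hX.le, ← Real.rpow_mul hΛ0.le, Real.rpow_sub hΛ0, neg_mul, Real.rpow_neg hΛ0.le,
    mul_comm (r - 1) s]
  ring

/-! ### From the equation to growth inequalities -/

namespace IsSourcedWave

variable {n : ℕ} {T : EReal} {ε R r : ℝ} {w₀ w₁ : L2 n ℝ} {w wt g : ℝ → L2 n ℝ}

theorem velocityDominates (h : IsSourcedWave T ε R w₀ w₁ w wt r g) (hn : 1 ≤ n) {a τ : ℝ}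
    (ha : 0 ≤ a) (hτ : τ ∈ timeInterval T) :
    VelocityDominates (volume.real (Metric.ball (0 : Space n) 1) * (1 / 2 * (2 * R + 5) ^ (-a))) a τ
      (fun s => waveFunctional a R s (wt s)) (fun s => ∫ x, |g s x| ^ r) := by
  refine ⟨fun s => integral_nonneg fun x => Real.rpow_nonneg (abs_nonneg _) _,
    (h.slice_one hτ).2, fun t ht => ?_⟩
  have ht' : t ∈ timeInterval T :=
    Icc_subset_timeInterval hτ ⟨zero_le_one.trans ht.1, ht.2⟩
  rw [mul_assoc]
  exact le_waveFunctional hn ha (integrable_of_supportedInBall (h.supp_deriv t ht'))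
    fun e he => (h.velocity_moment_ge ht' ha he).2 ht.1

theorem positionDominates (h : IsSourcedWave T ε R w₀ w₁ w wt r g) (hn : 1 ≤ n) {a τ : ℝ}
    (ha : 0 ≤ a) (hτ : τ ∈ timeInterval T) :
    PositionDominates (volume.real (Metric.ball (0 : Space n) 1) * (1 / 2 * (2 * R + 6) ^ (-a))) a τ
      (fun s => waveFunctional a R s (w s)) (fun s => ∫ x, |g s x| ^ r) := by
  refine ⟨fun s => integral_nonneg fun x => Real.rpow_nonneg (abs_nonneg _) _,
    (h.slice_one hτ).2, fun δ hδ hδ1 t ht => ?_⟩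
  have ht' : t ∈ timeInterval T :=
    Icc_subset_timeInterval hτ ⟨by linarith [ht.1], ht.2⟩
  rw [mul_assoc, mul_assoc, ← mul_assoc (1 / 2 * (2 * R + 6) ^ (-a))]
  exact le_waveFunctional hn ha (integrable_of_supportedInBall (h.supp t ht'))
    fun e he => (h.position_moment_ge ht' ha he).2 δ hδ hδ1 ht.1

theorem waveFunctional_velocity_ge (h : IsSourcedWave T ε R w₀ w₁ w wt r g) (hn : 1 ≤ n) {a t : ℝ}
    (ha : 0 ≤ a) (ht : t ∈ timeInterval T) :
    volume.real (Metric.ball (0 : Space n) 1) * (1 / 2 * (2 * R + 2) ^ (-a) * ∫ x, w₁ x) * ε ≤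
      waveFunctional a R t (wt t) := by
  rw [mul_assoc, mul_comm _ ε]
  exact le_waveFunctional hn ha (integrable_of_supportedInBall (h.supp_deriv t ht))
    fun e he => (h.velocity_moment_ge ht ha he).1

theorem waveFunctional_position_ge (h : IsSourcedWave T ε R w₀ w₁ w wt r g) (hn : 1 ≤ n) {a t : ℝ}
    (ha : 0 ≤ a) (ht : t ∈ timeInterval T) :
    volume.real (Metric.ball (0 : Space n) 1) * (1 / 2 * (2 * R + 2) ^ (-a) * ∫ x, w₀ x) * ε ≤
      waveFunctional a R t (w t) := by
  rw [mul_assoc, mul_comm _ ε]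
  exact le_waveFunctional hn ha (integrable_of_supportedInBall (h.supp t ht))
    fun e he => (h.position_moment_ge ht ha he).1

theorem holderBound_source (h : IsSourcedWave T ε R w₀ w₁ w wt r g) {a C e k τ : ℝ}
    (hτ : τ ∈ timeInterval T)
    (hb : ∀ s : ℝ, 1 ≤ s → ∀ f : Space n → ℝ, Integrable f →
      (∀ᵐ x, s + R + 1 < ‖x‖ → f x = 0) → Integrable (fun x => |f x| ^ r) →
      |waveFunctional a R s f| ^ r ≤ C * s ^ e * (1 + Real.log s) ^ k * ∫ x, |f x| ^ r) :
    HolderBound C e k r τ (fun s => waveFunctional a R s (g s)) (fun s => ∫ x, |g s x| ^ r) := by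
  filter_upwards [(h.slice_one hτ).1] with s hs hs'
  have hs0 : s ∈ Ioc 0 τ := ⟨zero_lt_one.trans hs'.1, hs'.2⟩
  have hsT := Icc_subset_timeInterval hτ (Ioc_subset_Icc_self hs0)
  exact hb s hs'.1.le _ (integrable_of_supportedInBall (h.supp_source s hsT))
    (h.supp_source s hsT) (hs hs0)

end IsSourcedWave

theorem HolderBound.source_ge {C e r c ε Λ : ℝ} {G P : ℝ → ℝ}
    (h : HolderBound C e 0 r (Real.exp (2 * Λ)) G P) (hC : 0 < C) (hr : 0 < r) (hΛ : 1 ≤ Λ)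
    (hc : 0 ≤ c) (hε : 0 ≤ ε) (hG : ∀ s ∈ Icc 1 (Real.exp (2 * Λ)), c * ε ≤ G s) :
    AePowerGe P (C⁻¹ * c ^ r * ε ^ r) (-e) 1 (Real.exp (2 * Λ)) := by
  have h1 := h.power_step (κ := 0) (X := c * ε) hC le_rfl hr hΛ le_rfl le_rfl (by positivity)
    (fun s hs => by rw [Real.rpow_zero, mul_one]; exact hG s hs)
  rw [neg_zero, Real.rpow_zero, Real.rpow_zero, mul_one, mul_one, zero_mul, zero_sub,
    Real.mul_rpow hc hε, ← mul_assoc] at h1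
  exact h1

/-- The log-free Hölder bound, applied to a functional bounded below by the data, makes the source
at least of order ε^r s^(-e) from time 1 on. One pass of the chain with S = η = 1 uses up the times
until exp(Λ), where the iteration begins. -/
theorem growth_start_of_chain {F P : ℝ → ℝ} {c C e k r s κ c₁ ε Λ : ℝ} {G : ℝ → ℝ}
    (hC : 0 < C) (hr : 1 < r) (hΛ : 1 ≤ Λ) (hκ : κ = -e) (hc₁ : 0 ≤ c₁) (hε : 0 ≤ ε)
    (hH : HolderBound C e 0 r (Real.exp (2 * Λ)) G P)
    (hG : ∀ t ∈ Icc 1 (Real.exp (2 * Λ)), c₁ * ε ≤ G t)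
    (hchain : ∀ η S D : ℝ, 0 ≤ D → 1 ≤ S → 0 < η → η ≤ 1 →
      AePowerGe P D κ S (Real.exp (2 * Λ)) →
      PowerGe F (c * η ^ k * Λ ^ (1 : ℝ) * D ^ s) 0 (S * Real.exp (Λ * η)) (Real.exp (2 * Λ))) :
    PowerGe F (c * (C⁻¹ * c₁ ^ r) ^ s * ε ^ (r * s) * Λ) 0 (Real.exp Λ) (Real.exp (2 * Λ)) := by
  have h1 := hH.source_ge hC (by linarith) hΛ hc₁ hε hG
  rw [← hκ] at h1
  have h2 := hchain 1 1 _ (by positivity) le_rfl one_pos le_rfl h1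
  rw [mul_one, one_mul] at h2
  refine h2.mono le_rfl (by positivity) (le_of_eq ?_)
  have h3 : (C⁻¹ * c₁ ^ r * ε ^ r) ^ s = (C⁻¹ * c₁ ^ r) ^ s * ε ^ (r * s) := by
    rw [Real.mul_rpow (by positivity) (by positivity), ← Real.rpow_mul hε]
  rw [h3, Real.one_rpow, Real.rpow_one]
  ring

/-! ### The three critical cases -/

section Lifespan

variable {n : ℕ} {p q R : ℝ} {u₀ u₁ v₀ v₁ : L2 n ℝ}

theorem holderConst_zero (n : ℕ) {r R : ℝ} (hr : 1 < r) (hR : 0 < R) :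
    ∃ C : ℝ, 0 < C ∧ ∀ s : ℝ, 1 ≤ s → ∀ f : Space n → ℝ, Integrable f →
      (∀ᵐ x, s + R + 1 < ‖x‖ → f x = 0) → Integrable (fun x => |f x| ^ r) →
      |waveFunctional 0 R s f| ^ r ≤
        C * s ^ ((n : ℝ) * (r - 1)) * (1 + Real.log s) ^ (0 : ℝ) * ∫ x, |f x| ^ r := by
  simpa using waveFunctional_zero_rpow_le n hr hR

theorem holderConst_strip (hn : 2 ≤ n) {r R : ℝ} (hr : 1 < r) (hR : 0 < R) :
    ∃ C : ℝ, 0 < C ∧ ∀ s : ℝ, 1 ≤ s → ∀ f : Space n → ℝ, Integrable f →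
      (∀ᵐ x, s + R + 1 < ‖x‖ → f x = 0) → Integrable (fun x => |f x| ^ r) →
      |waveFunctional (((n : ℝ) - 1) / 2 + 1) R s f| ^ r ≤ C * s ^ (((n : ℝ) - 1) / 2 * (r - 2)) *
        (1 + Real.log s) ^ (0 : ℝ) * ∫ x, |f x| ^ r := by
  simpa using waveFunctional_strip_rpow_le hn hr hR

theorem exp_mem_timeInterval {T : EReal} {Λ : ℝ} (h : ((Real.exp (2 * Λ) : ℝ) : EReal) < T) :
    Real.exp (2 * Λ) ∈ timeInterval T := ⟨(Real.exp_pos _).le, h⟩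

theorem lifespan_of_velocity_critical (hn : 2 ≤ n) (hp : 1 < p) (hq : 1 < q) (hR : 0 < R)
    (hu₁ : 0 < ∫ x, u₁ x) (hcrit : q + 1 + p⁻¹ = ((n : ℝ) - 1) / 2 * (p * q - 1)) :
    ∃ C : ℝ, 0 < C ∧ ∀ (ε : ℝ) (T : EReal) (u ut v vt : ℝ → L2 n ℝ), ε ≤ 1 →
      IsSourcedWave T ε R u₀ u₁ u ut q v → IsSourcedWave T ε R v₀ v₁ v vt p ut →
      T ≤ (Real.exp (C * ε ^ (-(p * (p * q - 1)))) : ℝ) := by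
  have hV := volume_real_ball_pos n
  have hm : (0 : ℝ) < ((n : ℝ) - 1) / 2 := by
    have : (2 : ℝ) ≤ n := by exact_mod_cast hn
    linarith
  have hpinv : p⁻¹ < 1 := inv_lt_one_of_one_lt₀ hp
  have hpq : 1 < p * q := by nlinarith
  obtain ⟨C₀, hC₀, hb₀⟩ := holderConst_zero n hq hR
  obtain ⟨C₁, hC₁, hb₁⟩ := waveFunctional_log_rpow_le hn hp hR
  obtain ⟨C₂, hC₂, hb₂⟩ := holderConst_strip hn hp hR
  have ha : 0 ≤ ((n : ℝ) - 1) / 2 + 1 - p⁻¹ := by linarith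
  -- The loop runs from ∫|∂ₜu|^p through v with constant profile to ∫|v|^q and back to ∂ₜu. With n =
  -- 2m + 1, the exponent condition for a logarithm is exactly `hcrit`.
  obtain ⟨c, hc, hchain⟩ := velocity_position_chain
    (cA := volume.real (Metric.ball (0 : Space n) 1) *
      (1 / 2 * (2 * R + 5) ^ (-(((n : ℝ) - 1) / 2 + 1 - p⁻¹))))
    (cB := volume.real (Metric.ball (0 : Space n) 1) * (1 / 2 * (2 * R + 6) ^ (-(0 : ℝ))))
    (C := C₀) (a := ((n : ℝ) - 1) / 2 + 1 - p⁻¹) (κ := -(((n : ℝ) - 1) / 2 * (p - 2)))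
    (e := (n : ℝ) * (q - 1)) (q := q) (by positivity) (by positivity) hC₀ hq
    (by linear_combination hcrit)
  obtain ⟨C, hC, hlife⟩ := lifespan_of_superlinear_growth
    (c := c * ((C₁ * 3 ^ (p - 1))⁻¹) ^ q)
    (c₀ := c * (C₂⁻¹ * (volume.real (Metric.ball (0 : Space n) 1) *
      (1 / 2 * (2 * R + 2) ^ (-(((n : ℝ) - 1) / 2 + 1)) * ∫ x, u₁ x)) ^ p) ^ q)
    (θ := 1 - q * (p - 1)) (k := 2 * q + 1) (r := p * q) (σ := p * q) (ν := p * (p * q - 1))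
    hpq (by positivity) (by positivity) (by positivity)
    (mul_nonneg (by linarith) (by linarith)) (by linarith) (by ring)
  refine ⟨C, hC, fun ε T u ut v vt hε1 hU hV' => ?_⟩
  refine hlife ε T (fun s => waveFunctional (((n : ℝ) - 1) / 2 + 1 - p⁻¹) R s (ut s)) hU.eps_pos
    hε1 fun Λ hΛ hT => ?_
  have hτ := exp_mem_timeInterval hT
  have hchain' := fun η S D hD hS hη hη1 => hchain _ _ _ _ D S η Λ
    (hU.velocityDominates (by omega) ha hτ) (hV'.positionDominates (by omega) le_rfl hτ)
    (hU.holderBound_source hτ hb₀) hD hS hη hη1 hΛ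
  constructor
  · exact growth_start_of_chain hC₂ hp hΛ rfl (by positivity) hU.eps_pos.le
      (hV'.holderBound_source hτ hb₂)
      (fun t ht => hU.waveFunctional_velocity_ge (by omega) (by positivity)
        (Icc_subset_timeInterval hτ ⟨zero_le_one.trans ht.1, ht.2⟩)) hchain'
  · intro η S X hη hη1 hS hX hF
    exact growth_step_of_chain hC₁ hp hΛ rfl (hV'.holderBound_source hτ hb₁) hchain' hη hη1 hS hX hF

theorem lifespan_of_position_critical (hn : 2 ≤ n) (hp : 1 < p) (hq : 1 < q) (hR : 0 < R)
    (hv₀ : 0 < ∫ x, v₀ x) (hcrit : 2 + q⁻¹ = ((n : ℝ) - 1) / 2 * (p * q - 1)) :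
    ∃ C : ℝ, 0 < C ∧ ∀ (ε : ℝ) (T : EReal) (u ut v vt : ℝ → L2 n ℝ), ε ≤ 1 →
      IsSourcedWave T ε R u₀ u₁ u ut q v → IsSourcedWave T ε R v₀ v₁ v vt p ut →
      T ≤ (Real.exp (C * ε ^ (-(q * (p * q - 1)))) : ℝ) := by
  have hV := volume_real_ball_pos n
  have hm : (0 : ℝ) < ((n : ℝ) - 1) / 2 := by
    have : (2 : ℝ) ≤ n := by exact_mod_cast hn
    linarith
  have hqinv : q⁻¹ < 1 := inv_lt_one_of_one_lt₀ hq
  have hqp : 1 < q * p := by nlinarith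
  obtain ⟨C₀, hC₀, hb₀⟩ := holderConst_zero n hp hR
  obtain ⟨C₁, hC₁, hb₁⟩ := waveFunctional_log_rpow_le hn hq hR
  obtain ⟨C₂, hC₂, hb₂⟩ := holderConst_strip hn hq hR
  have hb : 0 ≤ ((n : ℝ) - 1) / 2 + 1 - q⁻¹ := by linarith
  -- The loop now starts from ∫|v|^q: the crude constant profile is used for ∂ₜu, the critical
  -- profile for v, and `hcrit` makes the integral for v logarithmic.
  obtain ⟨c, hc, hchain⟩ := position_velocity_chain
    (cA := volume.real (Metric.ball (0 : Space n) 1) * (1 / 2 * (2 * R + 5) ^ (-(0 : ℝ))))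
    (cB := volume.real (Metric.ball (0 : Space n) 1) *
      (1 / 2 * (2 * R + 6) ^ (-(((n : ℝ) - 1) / 2 + 1 - q⁻¹))))
    (C := C₀) (b := ((n : ℝ) - 1) / 2 + 1 - q⁻¹) (κ := -(((n : ℝ) - 1) / 2 * (q - 2)))
    (e := (n : ℝ) * (p - 1)) (p := p) (by positivity) (by positivity) hC₀ hp
    (by linear_combination hcrit)
  obtain ⟨C, hC, hlife⟩ := lifespan_of_superlinear_growth
    (c := c * ((C₁ * 3 ^ (q - 1))⁻¹) ^ p)
    (c₀ := c * (C₂⁻¹ * (volume.real (Metric.ball (0 : Space n) 1) *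
      (1 / 2 * (2 * R + 2) ^ (-(((n : ℝ) - 1) / 2 + 1)) * ∫ x, v₀ x)) ^ q) ^ p)
    (θ := 1 - p * (q - 1)) (k := p + 2) (r := q * p) (σ := q * p) (ν := q * (p * q - 1))
    hqp (by positivity) (by positivity) (by positivity)
    (mul_nonneg (by linarith) (by linarith)) (by linarith) (by ring)
  refine ⟨C, hC, fun ε T u ut v vt hε1 hU hV' => ?_⟩
  refine hlife ε T (fun s => waveFunctional (((n : ℝ) - 1) / 2 + 1 - q⁻¹) R s (v s)) hU.eps_pos
    hε1 fun Λ hΛ hT => ?_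
  have hτ := exp_mem_timeInterval hT
  have hchain' := fun η S D hD hS hη hη1 => hchain _ _ _ _ D S η Λ
    (hU.velocityDominates (by omega) le_rfl hτ) (hV'.positionDominates (by omega) hb hτ)
    (hV'.holderBound_source hτ hb₀) hD hS hη hη1 hΛ
  constructor
  · exact growth_start_of_chain hC₂ hq hΛ rfl (by positivity) hU.eps_pos.le
      (hU.holderBound_source hτ hb₂)
      (fun t ht => hV'.waveFunctional_position_ge (by omega) (by positivity)
        (Icc_subset_timeInterval hτ ⟨zero_le_one.trans ht.1, ht.2⟩)) hchain'
  · intro η S X hη hη1 hS hX hF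
    exact growth_step_of_chain hC₁ hq hΛ rfl (hU.holderBound_source hτ hb₁) hchain' hη hη1 hS hX hF

/-- These identities say that, with a = m + 1 - 1/p and b = m + 1 - 1/q, one has -m(q - 2) = a - 1
and -m(p - 2) = b - 2, so both time integrals of the loop are logarithmic. -/
theorem double_critical_exponents {m p q : ℝ} (hp : 1 < p) (hq : 1 < q)
    (h₁ : q + 1 + p⁻¹ = m * (p * q - 1)) (h₂ : 2 + q⁻¹ = m * (p * q - 1)) :
    m * (q - 1) = p⁻¹ ∧ m * (p - 1) = 1 + q⁻¹ := by
  have hp0 : p ≠ 0 := by positivity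
  have hq0 : q ≠ 0 := by positivity
  have hpq : p * q - 1 ≠ 0 := by nlinarith
  have e₁ : p * q * (q - 1) = p - q := by
    have := h₁.trans h₂.symm
    field_simp at this
    linear_combination this
  have e₂ : 2 * q + 1 = m * q * (p * q - 1) := by
    field_simp at h₂
    linear_combination h₂
  have e₃ : m * p * (q - 1) = 1 := by
    have : (m * p * (q - 1) - 1) * (q * (p * q - 1)) = 0 := by
      linear_combination (-p * (q - 1)) * e₂ + e₁
    rcases mul_eq_zero.1 this with h | h
    · linarith
    · rcases mul_eq_zero.1 h with h | h <;> contradiction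
  have e₄ : m * (q - 1) = p⁻¹ := by field_simp; linear_combination e₃
  refine ⟨e₄, mul_left_cancel₀ hq0 ?_⟩
  rw [mul_add, mul_inv_cancel₀ hq0]
  linear_combination -h₁ - e₄

theorem lifespan_of_double_critical (hn : 2 ≤ n) (hp : 1 < p) (hq : 1 < q) (hR : 0 < R)
    (hv₀ : 0 < ∫ x, v₀ x) (hcrit₁ : q + 1 + p⁻¹ = ((n : ℝ) - 1) / 2 * (p * q - 1))
    (hcrit₂ : 2 + q⁻¹ = ((n : ℝ) - 1) / 2 * (p * q - 1)) :
    ∃ C : ℝ, 0 < C ∧ ∀ (ε : ℝ) (T : EReal) (u ut v vt : ℝ → L2 n ℝ), ε ≤ 1 →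
      IsSourcedWave T ε R u₀ u₁ u ut q v → IsSourcedWave T ε R v₀ v₁ v vt p ut →
      T ≤ (Real.exp (C * ε ^ (-(q / (q + 1) * (p * q - 1)))) : ℝ) := by
  have hV := volume_real_ball_pos n
  have hm : (0 : ℝ) < ((n : ℝ) - 1) / 2 := by
    have : (2 : ℝ) ≤ n := by exact_mod_cast hn
    linarith
  have hpinv : p⁻¹ < 1 := inv_lt_one_of_one_lt₀ hp
  have hqinv : q⁻¹ < 1 := inv_lt_one_of_one_lt₀ hq
  have hpq : 1 < p * q := by nlinarith
  obtain ⟨hd₁, hd₂⟩ := double_critical_exponents hp hq hcrit₁ hcrit₂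
  obtain ⟨C₀, hC₀, hb₀⟩ := waveFunctional_log_rpow_le hn hq hR
  obtain ⟨C₁, hC₁, hb₁⟩ := waveFunctional_log_rpow_le hn hp hR
  obtain ⟨C₂, hC₂, hb₂⟩ := holderConst_strip hn hq hR
  have ha : 0 ≤ ((n : ℝ) - 1) / 2 + 1 - p⁻¹ := by linarith
  have hb : 0 ≤ ((n : ℝ) - 1) / 2 + 1 - q⁻¹ := by linarith
  set cA := volume.real (Metric.ball (0 : Space n) 1) *
    (1 / 2 * (2 * R + 5) ^ (-(((n : ℝ) - 1) / 2 + 1 - p⁻¹))) with hcA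
  have hcA0 : 0 < cA := by positivity
  have hexpA : -(((n : ℝ) - 1) / 2 * (q - 2)) = ((n : ℝ) - 1) / 2 + 1 - p⁻¹ - 1 := by
    linear_combination -hd₁
  obtain ⟨c, hc, hchain⟩ := log_log_chain (cA := cA)
    (cB := volume.real (Metric.ball (0 : Space n) 1) *
      (1 / 2 * (2 * R + 6) ^ (-(((n : ℝ) - 1) / 2 + 1 - q⁻¹))))
    (C := C₀) (a := ((n : ℝ) - 1) / 2 + 1 - p⁻¹) (b := ((n : ℝ) - 1) / 2 + 1 - q⁻¹)
    (κ := -(((n : ℝ) - 1) / 2 * (p - 2))) (e := ((n : ℝ) - 1) / 2 * (q - 2)) (q := q)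
    hcA0 (by positivity) hC₀ hq (by linear_combination -hd₂) hexpA
  set c₁ := volume.real (Metric.ball (0 : Space n) 1) *
      (1 / 2 * (2 * R + 2) ^ (-(((n : ℝ) - 1) / 2 + 1)) * ∫ x, v₀ x) with hc₁
  have hc₁0 : 0 < c₁ := by positivity
  -- Here σ = q rather than pq: the data of v reach the functional of ∂ₜu in a single logarithmic
  -- step. Moreover θ + pq - 1 = q + 1, the source of the denominator in the exponent.
  obtain ⟨C, hC, hlife⟩ := lifespan_of_superlinear_growth
    (c := c * ((C₁ * 3 ^ (p - 1))⁻¹) ^ q) (c₀ := cA * (C₂⁻¹ * c₁ ^ q))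
    (θ := 2 - q * (p - 1)) (k := 2 * q + 1) (r := p * q) (σ := q) (ν := q / (q + 1) * (p * q - 1))
    hpq (by positivity) (by positivity) (by positivity)
    (mul_nonneg (by positivity) (by linarith)) (by linarith) (by field_simp; ring)
  refine ⟨C, hC, fun ε T u ut v vt hε1 hU hV' => ?_⟩
  have hε := hU.eps_pos
  refine hlife ε T (fun s => waveFunctional (((n : ℝ) - 1) / 2 + 1 - p⁻¹) R s (ut s)) hε
    hε1 fun Λ hΛ hT => ?_
  have hτ := exp_mem_timeInterval hT
  have hA := hU.velocityDominates (a := ((n : ℝ) - 1) / 2 + 1 - p⁻¹) (by omega) ha hτ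
  constructor
  -- Start from v₀: the log-free bound gives ∫|v|^q of order at least ε^q s^(-m(q-2)), and the
  -- resonance -m(q - 2) = a - 1 gives ε^q Λ for ∂ₜu.
  · have h1 := (hU.holderBound_source hτ hb₂).source_ge hC₂ (by linarith) hΛ hc₁0.le hε.le
      (fun t ht => hV'.waveFunctional_position_ge (by omega) (by positivity)
        (Icc_subset_timeInterval hτ ⟨zero_le_one.trans ht.1, ht.2⟩))
    have h2 := hA.log_step hcA0 hexpA (by positivity) le_rfl one_pos hΛ h1
    exact h2.mono (by simp) (by positivity) (le_of_eq (by ring))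
  · intro η S X hη hη1 hS hX hF
    exact growth_step_of_chain hC₁ hp hΛ rfl (hV'.holderBound_source hτ hb₁)
      (fun η S D hD hS hη hη1 => hchain _ _ _ _ D S η Λ hA
        (hV'.positionDominates (by omega) hb hτ) (hU.holderBound_source hτ hb₀) hD hS hη hη1 hΛ)
      hη hη1 hS hX hF

end Lifespan

/-! ### Assembly -/

theorem integral_pos_of_supportedInBall {n : ℕ} {ρ : ℝ} {f : L2 n ℝ} (hf : SupportedInBall ρ f)
    (h0 : ∀ᵐ x, 0 ≤ f x) (hne : f ≠ 0) : 0 < ∫ x, f x := by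
  refine (integral_nonneg_of_ae h0).lt_of_ne' fun h => hne ?_
  have := (integral_eq_zero_iff_of_nonneg_ae h0 (integrable_of_supportedInBall hf)).1 h
  exact Lp.eq_zero_iff_ae_eq_zero.2 this

theorem SupportedInBall.mono {n : ℕ} {ρ ρ' : ℝ} {f : L2 n ℝ} (hf : SupportedInBall ρ f)
    (h : ρ ≤ ρ') : SupportedInBall ρ' f := by
  filter_upwards [hf] with x hx hx'
  exact hx (by linarith)

theorem theorem2 (n : ℕ) (hn : 2 ≤ n) (p q : ℝ) (hp : 1 < p) (hq : 1 < q)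
    (hcrit : max ((q + 1 + p⁻¹) / (p * q - 1)) ((2 + q⁻¹) / (p * q - 1)) = ((n : ℝ) - 1) / 2)
    (R : ℝ) (hR : 0 < R) (u₀ u₁ v₀ v₁ : L2 n ℝ)
    (hu₀ : MemH1 u₀) (hv₀ : MemH1 v₀)
    (hu₀_nonneg : ∀ᵐ x, 0 ≤ u₀ x) (hu₁_nonneg : ∀ᵐ x, 0 ≤ u₁ x)
    (hv₀_nonneg : ∀ᵐ x, 0 ≤ v₀ x) (hv₁_nonneg : ∀ᵐ x, 0 ≤ v₁ x)
    (hu₀_supp : SupportedInBall R u₀) (hu₁_supp : SupportedInBall R u₁)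
    (hv₀_supp : SupportedInBall R v₀) (hv₁_supp : SupportedInBall R v₁)
    (hu₁_ne : u₁ ≠ 0) (hv₀_ne : v₀ ≠ 0) :
    ∃ ε₀ : ℝ, 0 < ε₀ ∧ ∃ C : ℝ, 0 < C ∧
      ∀ ε : ℝ, 0 < ε → ε ≤ ε₀ →
        ∀ (T : EReal) (u v : ℝ → L2 n ℝ),
          IsWeakSolution p q ε u₀ u₁ v₀ v₁ T u v →
          SupportedInCone T R u → SupportedInCone T R v →
            T < ⊤ ∧
            (Θ₁ n p q = 0 →
              T ≤ (Real.exp (C * ε ^ (-(p * (p * q - 1)))) : ℝ)) ∧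
            (Θ₂ n p q = 0 →
              T ≤ (Real.exp (C * ε ^ (-(q * (p * q - 1)))) : ℝ)) ∧
            (Θ₁ n p q = 0 → Θ₂ n p q = 0 →
              T ≤ (Real.exp (C * ε ^ (-(q / (q + 1) * (p * q - 1)))) : ℝ)) := by
  have hpq : 0 < p * q - 1 := by nlinarith
  have hΘ₁ : Θ₁ n p q = 0 → q + 1 + p⁻¹ = ((n : ℝ) - 1) / 2 * (p * q - 1) := by
    intro h
    rw [Θ₁, sub_eq_zero, div_eq_iff hpq.ne'] at h
    exact h
  have hΘ₂ : Θ₂ n p q = 0 → 2 + q⁻¹ = ((n : ℝ) - 1) / 2 * (p * q - 1) := by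
    intro h
    rw [Θ₂, sub_eq_zero, div_eq_iff hpq.ne'] at h
    exact h
  have hor : Θ₁ n p q = 0 ∨ Θ₂ n p q = 0 := by
    rcases max_choice ((q + 1 + p⁻¹) / (p * q - 1)) ((2 + q⁻¹) / (p * q - 1)) with h | h
    · left; rw [Θ₁, ← hcrit, h, sub_self]
    · right; rw [Θ₂, ← hcrit, h, sub_self]
  have hu₁_int := integral_pos_of_supportedInBall hu₁_supp hu₁_nonneg hu₁_ne
  have hv₀_int := integral_pos_of_supportedInBall hv₀_supp hv₀_nonneg hv₀_ne
  -- Each case supplies a constant only under its own condition φ. When φ fails any constant will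
  -- do, and a valid constant may be increased, so the sum of the three serves for all cases at
  -- once.
  have enlarge : ∀ {φ : Prop} {ν : ℝ}, (φ → ∃ C : ℝ, 0 < C ∧
      ∀ (ε : ℝ) (T : EReal) (u ut v vt : ℝ → L2 n ℝ), ε ≤ 1 →
      IsSourcedWave T ε R u₀ u₁ u ut q v → IsSourcedWave T ε R v₀ v₁ v vt p ut →
      T ≤ (Real.exp (C * ε ^ ν) : ℝ)) → ∃ C₀ : ℝ, 0 < C₀ ∧ ∀ C : ℝ, C₀ ≤ C →
      ∀ (ε : ℝ) (T : EReal) (u ut v vt : ℝ → L2 n ℝ), ε ≤ 1 →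
      IsSourcedWave T ε R u₀ u₁ u ut q v → IsSourcedWave T ε R v₀ v₁ v vt p ut → φ →
      T ≤ (Real.exp (C * ε ^ ν) : ℝ) := by
    intro φ ν h
    by_cases hφ : φ
    · obtain ⟨C₀, hC₀, h⟩ := h hφ
      refine ⟨C₀, hC₀, fun C hC ε T u ut v vt hε hU hV _ => (h ε T u ut v vt hε hU hV).trans ?_⟩
      have := mul_le_mul_of_nonneg_right hC (Real.rpow_nonneg hU.eps_pos.le ν)
      exact_mod_cast Real.exp_le_exp.2 this
    · exact ⟨1, one_pos, fun C _ ε T u ut v vt _ _ _ h => absurd h hφ⟩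
  obtain ⟨C₁, hC₁, h₁⟩ := enlarge fun h : Θ₁ n p q = 0 =>
    lifespan_of_velocity_critical (u₀ := u₀) (v₀ := v₀) (v₁ := v₁) hn hp hq hR hu₁_int (hΘ₁ h)
  obtain ⟨C₂, hC₂, h₂⟩ := enlarge fun h : Θ₂ n p q = 0 =>
    lifespan_of_position_critical (u₀ := u₀) (u₁ := u₁) (v₁ := v₁) hn hp hq hR hv₀_int (hΘ₂ h)
  obtain ⟨C₃, hC₃, h₃⟩ := enlarge fun h : Θ₁ n p q = 0 ∧ Θ₂ n p q = 0 =>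
    lifespan_of_double_critical (u₀ := u₀) (u₁ := u₁) (v₁ := v₁) hn hp hq hR hv₀_int
      (hΘ₁ h.1) (hΘ₂ h.2)
  refine ⟨1, one_pos, C₁ + C₂ + C₃, by positivity, fun ε hε hε1 T u v hsol hu hv => ?_⟩
  have hsu : ∀ s ∈ timeInterval T, SupportedInBall (s + R + 1) (u s) := fun s hs =>
    (hu s hs).mono (by linarith)
  have hsv : ∀ s ∈ timeInterval T, SupportedInBall (s + R + 1) (v s) := fun s hs =>
    (hv s hs).mono (by linarith)
  have hsut : ∀ s ∈ timeInterval T, SupportedInBall (s + R + 1) (timeDeriv T u s) := fun s hs =>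
    supportedInBall_timeDeriv hsol.pos hsol.u_C1 hu hs
  have hsvt : ∀ s ∈ timeInterval T, SupportedInBall (s + R + 1) (timeDeriv T v s) := fun s hs =>
    supportedInBall_timeDeriv hsol.pos hsol.v_C1 hv hs
  have hU : IsSourcedWave T ε R u₀ u₁ u (timeDeriv T u) q v :=
    ⟨hsu, hsut, hsv, hu₀_supp, hu₁_supp, hu₀_nonneg, hu₁_nonneg, hε, hR, hq, hsol.v_loc, hsol.eq_u⟩
  have hV : IsSourcedWave T ε R v₀ v₁ v (timeDeriv T v) p (timeDeriv T u) :=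
    ⟨hsv, hsvt, hsut, hv₀_supp, hv₁_supp, hv₀_nonneg, hv₁_nonneg, hε, hR, hp, hsol.ut_loc,
      hsol.eq_v⟩
  have b₁ := h₁ (C₁ + C₂ + C₃) (by linarith) ε T u _ v _ hε1 hU hV
  have b₂ := h₂ (C₁ + C₂ + C₃) (by linarith) ε T u _ v _ hε1 hU hV
  have b₃ := h₃ (C₁ + C₂ + C₃) (by linarith) ε T u _ v _ hε1 hU hV
  refine ⟨?_, b₁, b₂, fun x y => b₃ ⟨x, y⟩⟩
  rcases hor with h | h
  · exact (b₁ h).trans_lt (EReal.coe_lt_top _)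
  · exact (b₂ h).trans_lt (EReal.coe_lt_top _)
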